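/- Let $M$ be an $m$-dimensional smooth manifold (Hausdorff, second countable) and $\mathbf{T}M=TM\oplus T^*M$, with the neutral metric $g((X,\alpha),(Y,\mu))=\alpha(Y)+\mu(X)$ and the Courant bracket $[(X,\alpha),(Y,\mu)]=([X,Y],L_X\mu-L_Y\alpha+\frac12 d(\alpha(Y)-\mu(X)))$. Let $\tau\in End(\mathbf{T}M)$ be a generalized 2-nilpotent structure, i.e. a smooth endomorphism of constant rank with $\tau^2=0$ and $g(\mathcal X,\tau\mathcal Y)+g(\tau\mathcal X,\mathcal Y)=0$. Put $E=\mathrm{im}\,\tau$; then $E^{\perp_g}=\ker\tau$, and $\mathcal X\mapsto g(\mathcal X,\cdot)|_E$ identifies $\mathbf{T}M/E^{\perp_g}$ with the dual bundle $E^*$. Let $\sharp_\Lambda:E^*\to E$ be the isomorphism $[\mathcal X]\mapsto\tau\mathcal X$ and $\Lambda\in\Gamma\wedge^2E$ the bivector field $\Lambda(\alpha,\beta)=\beta(\sharp_\Lambda\alpha)$, i.e. $\Lambda([\mathcal X],[\mathcal Y])=g(\tau\mathcal X,\mathcal Y)$. Assume that $\tau$ is weakly integrable, i.e. $\Gamma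 E$ is closed under the Courant bracket, so that $E$ with the Courant bracket $[\,,]_E$ and the anchor $\rho=pr_{TM}$ is a Lie algebroid, with differential $d_E$ and Lie derivative $L$. On $\Gamma E^*$ consider the Gelfand–Dorfman bracket $$\{\alpha,\beta\}_\Lambda=L_{\sharp_\Lambda\alpha}\beta-L_{\sharp_\Lambda\beta}\alpha-d_E(\Lambda(\alpha,\beta)).$$ Call $\tau$ integrable if $[\tau\mathcal X,\tau\mathcal Y]-\tau[\mathcal X,\tau\mathcal Y]-\tau[\tau\mathcal X,\mathcal Y]+\tau^2[\mathcal X,\mathcal Y]=0$ for all $\mathcal X,\mathcal Y\in\Gamma\mathbf{T}M$. Then the following hold. (1) $\tau$ is integrable if and only if $(E^*,\{\,,\}_\Lambda,\sharp_\Lambda)$ is a Lie algebroid with anchor $\sharp_\Lambda:E^*\to E$ over the Lie algebroid $E$; that is, $\{\,,\}_\Lambda$ and the composed anchor $\rho\circ\sharp_\Lambda:E^*\to TM$ satisfy the axioms of a Lie algebroid on $M$, and $\sharp_\Lambda\{\alpha,\beta\}_\Lambda=[\sharp_\Lambda\alpha,\sharp_\Lambda\beta]_E$ for all $\alpha,\beta\in\Gamma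 E^*$. (2) $\tau$ is integrable if and only if $(E,E^*)$, with the above brackets and with the anchors $\rho$, $\rho\circ\sharp_\Lambda$, is a triangular Lie bialgebroid; that is, $E$ and $E^*$ are Lie algebroids, $d_*[e,e']=[d_*e,e']+[e,d_*e']$ for all $e,e'\in\Gamma E$, where $d_*$ is the differential of $E^*$ and the brackets are Schouten brackets of $E$, and $[\Lambda,\Lambda]=0$. -/

import Mathlib

open scoped Manifold ContDiff Bundle

noncomputable section

namespace GenGeom

/-! ### Linear algebra -/

/-- The linear map `D → W` induced by `q : V → W`, when `p : V → D` is onto and `q` vanishes on the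
kernel of `p`: it maps `p v` to `q v`. -/
def descend {V D W : Type*} [AddCommGroup V] [Module ℝ V] [AddCommGroup D] [Module ℝ D]
    [AddCommGroup W] [Module ℝ W] (p : V →ₗ[ℝ] D) (hp : Function.Surjective p) (q : V →ₗ[ℝ] W)
    (h : ∀ v, p v = 0 → q v = 0) : D →ₗ[ℝ] W :=
  ((LinearMap.ker p).liftQ q h) ∘ₗ (p.quotKerEquivOfSurjective hp).symm.toLinearMap

theorem descend_apply {V D W : Type*} [AddCommGroup V] [Module ℝ V] [AddCommGroup D] [Module ℝ D]
    [AddCommGroup W] [Module ℝ W] (p : V →ₗ[ℝ] D) (hp : Function.Surjective p) (q : V →ₗ[ℝ] W)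
    (h : ∀ v, p v = 0 → q v = 0) (v : V) : descend p hp q h (p v) = q v := by
  have h1 : (p.quotKerEquivOfSurjective hp).symm (p v) = Submodule.Quotient.mk v := by
    rw [LinearEquiv.symm_apply_eq]
    rfl
  rw [descend, LinearMap.comp_apply, LinearEquiv.coe_coe, h1]
  rfl

theorem restrict_surjective {V : Type*} [AddCommGroup V] [Module ℝ V] (U : Submodule ℝ V)
    (B : V →ₗ[ℝ] Module.Dual ℝ V) (hB : Function.Surjective B) :
    Function.Surjective (U.subtype.dualMap ∘ₗ B) :=
  (LinearMap.dualMap_surjective_of_injective U.injective_subtype).comp hB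

variable {m : ℕ} {M : Type*} [TopologicalSpace M] [ChartedSpace (EuclideanSpace ℝ (Fin m)) M]

/-! ### The big tangent bundle and the Courant bracket -/

/-- The cotangent space at `x`. -/
abbrev Cotangent (m : ℕ) {M : Type*} [TopologicalSpace M]
    [ChartedSpace (EuclideanSpace ℝ (Fin m)) M] (x : M) : Type :=
  TangentSpace (𝓡 m) x →L[ℝ] ℝ

/-- The fibre `T_xM ⊕ T_x^*M` of the big tangent bundle. -/
abbrev BigTangent (m : ℕ) {M : Type*} [TopologicalSpace M]
    [ChartedSpace (EuclideanSpace ℝ (Fin m)) M] (x : M) : Type :=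
  TangentSpace (𝓡 m) x × Cotangent m x

instance (x : M) : FiniteDimensional ℝ (TangentSpace (𝓡 m) x) :=
  inferInstanceAs (FiniteDimensional ℝ (EuclideanSpace ℝ (Fin m)))

instance (x : M) : T2Space (TangentSpace (𝓡 m) x) :=
  inferInstanceAs (T2Space (EuclideanSpace ℝ (Fin m)))

/-- The derivative `X(f) = df(X)` of a function along a vector field. -/
def dirDeriv (X : ∀ x : M, TangentSpace (𝓡 m) x) (f : M → ℝ) (x : M) : ℝ :=
  mvfderiv (𝓡 m) f x (X x)

/-- Smooth functions on `M`. -/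
def IsSmoothFun (m : ℕ) {M : Type*} [TopologicalSpace M]
    [ChartedSpace (EuclideanSpace ℝ (Fin m)) M] (f : M → ℝ) : Prop :=
  ContMDiff (𝓡 m) 𝓘(ℝ, ℝ) ∞ f

/-- The neutral metric `g((X, α), (Y, μ)) = α(Y) + μ(X)`. -/
def g (x : M) : BigTangent m x →ₗ[ℝ] BigTangent m x →ₗ[ℝ] ℝ :=
  LinearMap.mk₂ ℝ (fun v w => v.2 w.1 + w.2 v.1)
    (fun _ _ _ => by simp; ring) (fun _ _ _ => by simp; ring)
    (fun _ _ _ => by simp; ring) (fun _ _ _ => by simp; ring)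

theorem g_apply (x : M) (v w : BigTangent m x) : g x v w = v.2 w.1 + w.2 v.1 := rfl

theorem g_injective (x : M) : Function.Injective (g (m := m) x) := by
  rw [injective_iff_map_eq_zero]
  rintro ⟨X, α⟩ h
  have hα : α = 0 := by
    ext Y
    simpa [g_apply] using LinearMap.congr_fun h (Y, 0)
  have hX : X = 0 := by
    rw [← Module.forall_dual_apply_eq_zero_iff ℝ X]
    intro φ
    simpa [g_apply] using LinearMap.congr_fun h (0, LinearMap.toContinuousLinearMap φ)
  rw [hα, hX]
  rfl

theorem g_surjective (x : M) : Function.Surjective (g (m := m) x) :=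
  (LinearMap.injective_iff_surjective_of_finrank_eq_finrank
    (Subspace.dual_finrank_eq (K := ℝ) (V := BigTangent m x)).symm).1 (g_injective x)

variable [IsManifold (𝓡 m) ∞ M]

/-- Smooth vector fields on `M`. -/
def IsSmoothVectorField (X : ∀ x : M, TangentSpace (𝓡 m) x) : Prop :=
  ContMDiff (𝓡 m) (𝓡 m).tangent ∞ (fun x => (⟨x, X x⟩ : TangentBundle (𝓡 m) M))

/-- Smooth `1`-forms on `M`, i.e. smooth sections of the bundle `Hom(TM, ℝ)`. -/
def IsSmoothOneForm (α : ∀ x : M, Cotangent m x) : Prop :=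
  ContMDiff (𝓡 m) ((𝓡 m).prod 𝓘(ℝ, EuclideanSpace ℝ (Fin m) →L[ℝ] ℝ)) ∞
    (fun x => Bundle.TotalSpace.mk' (EuclideanSpace ℝ (Fin m) →L[ℝ] ℝ)
      (E := fun x : M => TangentSpace (𝓡 m) x →L[ℝ] Bundle.Trivial M ℝ x) x (α x))

/-- Smooth sections of the big tangent bundle `TM ⊕ T*M`. -/
def IsSmoothSection (s : ∀ x : M, BigTangent m x) : Prop :=
  IsSmoothVectorField (fun x => (s x).1) ∧ IsSmoothOneForm (fun x => (s x).2)

/-- The value at `x` and on `Z` of the Lie derivative `L_X μ` of a `1`-form: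
`(L_X μ)(Z) = X(μ(Z)) - μ([X, Z])`. -/
def lieFormOn (X : ∀ x : M, TangentSpace (𝓡 m) x) (μ : ∀ x : M, Cotangent m x) (x : M)
    (Z : ∀ x : M, TangentSpace (𝓡 m) x) : ℝ :=
  dirDeriv X (fun y => μ y (Z y)) x - μ x (VectorField.mlieBracket (𝓡 m) X Z x)

/-- The expression `X(μ(Z)) - μ([X, Z])` is tensorial in `Z`, so that it defines a `1`-form. -/
theorem tensorialAt_lieFormOn {X : ∀ x : M, TangentSpace (𝓡 m) x}
    {μ : ∀ x : M, Cotangent m x} (hμ : IsSmoothOneForm μ) (x : M) :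
    TensorialAt (𝓡 m) (EuclideanSpace ℝ (Fin m)) (lieFormOn X μ x) x := by
  have key : ∀ {σ : ∀ x : M, TangentSpace (𝓡 m) x},
      MDifferentiableAt (𝓡 m) (𝓡 m).tangent (fun y => (⟨y, σ y⟩ : TangentBundle (𝓡 m) M)) x →
      MDifferentiableAt (𝓡 m) 𝓘(ℝ, ℝ) (fun y => μ y (σ y)) x := by
    intro σ hσ
    have h := MDifferentiableAt.clm_bundle_apply (E₂ := fun y : M => Bundle.Trivial M ℝ y)
      (F₂ := ℝ) ((hμ x).mdifferentiableAt (by simp)) hσ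
    rw [mdifferentiableAt_section] at h
    exact h
  constructor
  · intro f σ hf hσ
    have h1 := key hσ
    have h2 : (fun y => μ y ((f • σ) y)) = f * (fun y => μ y (σ y)) := by
      funext y
      simp
    simp only [lieFormOn, dirDeriv]
    rw [VectorField.mlieBracket_smul_right hf hσ, h2, mvfderiv_mul hf h1]
    simp
    ring
  · intro σ σ' hσ hσ'
    have h1 := key hσ
    have h2 := key hσ'
    have h3 : (fun y => μ y ((σ + σ') y)) = (fun y => μ y (σ y)) + (fun y => μ y (σ' y)) := by
      funext y
      simp
    simp only [lieFormOn, dirDeriv]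
    rw [VectorField.mlieBracket_add_right hσ hσ', h3, mvfderiv_add h1 h2]
    simp
    ring

/-- The Lie derivative `L_X μ` of a `1`-form along a vector field. By `tensorialAt_lieFormOn`, the
dummy value `0` is never taken when `μ` is smooth. -/
def lieForm (X : ∀ x : M, TangentSpace (𝓡 m) x) (μ : ∀ x : M, Cotangent m x) (x : M) :
    Cotangent m x :=
  open Classical in
  if h : TensorialAt (𝓡 m) (EuclideanSpace ℝ (Fin m)) (lieFormOn X μ x) x then
    TensorialAt.mkHom _ x h
  else 0

/-- `(L_X μ)(Z) = X(μ(Z)) - μ([X, Z])`. -/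
theorem lieForm_apply {X : ∀ x : M, TangentSpace (𝓡 m) x} {μ : ∀ x : M, Cotangent m x}
    (hμ : IsSmoothOneForm μ) {Z : ∀ x : M, TangentSpace (𝓡 m) x} (hZ : IsSmoothVectorField Z)
    (x : M) :
    lieForm X μ x (Z x) =
      dirDeriv X (fun y => μ y (Z y)) x - μ x (VectorField.mlieBracket (𝓡 m) X Z x) := by
  rw [lieForm, dif_pos (tensorialAt_lieFormOn hμ x),
    TensorialAt.mkHom_apply _ ((hZ x).mdifferentiableAt (by simp))]
  rfl

/-- The Courant bracket
`[(X, α), (Y, μ)] = ([X, Y], L_X μ - L_Y α + (1/2) d(α(Y) - μ(X)))`. -/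
def courant (s t : ∀ x : M, BigTangent m x) (x : M) : BigTangent m x :=
  (VectorField.mlieBracket (𝓡 m) (fun y => (s y).1) (fun y => (t y).1) x,
    lieForm (fun y => (s y).1) (fun y => (t y).2) x
      - lieForm (fun y => (t y).1) (fun y => (s y).2) x
      + (1 / 2 : ℝ) • mvfderiv (𝓡 m) (fun y => (s y).2 (t y).1 - (t y).2 (s y).1) x)

/-! ### Lie algebroids -/

/-- The axioms of a Lie algebroid over `M` for a vector bundle with fibres `V x` and set `Γ` of
smooth sections, a bracket of sections and an anchor `ρ : V → TM`. -/
structure IsLieAlgebroid {V : M → Type*} [∀ x, AddCommGroup (V x)] [∀ x, Module ℝ (V x)]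
    (Γ : Set (∀ x, V x)) (bracket : (∀ x, V x) → (∀ x, V x) → ∀ x, V x)
    (ρ : ∀ x, V x →ₗ[ℝ] TangentSpace (𝓡 m) x) : Prop where
  bracket_mem : ∀ a ∈ Γ, ∀ b ∈ Γ, bracket a b ∈ Γ
  anchor_smooth : ∀ a ∈ Γ, IsSmoothVectorField (fun x => ρ x (a x))
  add_left : ∀ a ∈ Γ, ∀ b ∈ Γ, ∀ c ∈ Γ, bracket (a + b) c = bracket a c + bracket b c
  smul_left : ∀ r : ℝ, ∀ a ∈ Γ, ∀ b ∈ Γ, bracket (r • a) b = r • bracket a b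
  skew : ∀ a ∈ Γ, ∀ b ∈ Γ, bracket a b = -bracket b a
  jacobi : ∀ a ∈ Γ, ∀ b ∈ Γ, ∀ c ∈ Γ,
    bracket (bracket a b) c + bracket (bracket b c) a + bracket (bracket c a) b = 0
  leibniz : ∀ f : M → ℝ, IsSmoothFun m f → ∀ a ∈ Γ, ∀ b ∈ Γ, ∀ x,
    bracket a (fun y => f y • b y) x =
      f x • bracket a b x + dirDeriv (fun y => ρ y (a y)) f x • b x
  anchor_bracket : ∀ a ∈ Γ, ∀ b ∈ Γ, ∀ x,
    ρ x (bracket a b x) =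
      VectorField.mlieBracket (𝓡 m) (fun y => ρ y (a y)) (fun y => ρ y (b y)) x

/-! ### Generalized 2-nilpotent structures -/

/-- A generalized 2-nilpotent structure: a smooth endomorphism `τ` of `TM ⊕ T*M`, of constant rank,
with `τ² = 0` and `g(v, τ w) + g(τ v, w) = 0`. (A family of linear maps of the fibres is smooth if
and only if it maps smooth sections to smooth sections.) -/
structure TwoNilpotent (m : ℕ) (M : Type*) [TopologicalSpace M]
    [ChartedSpace (EuclideanSpace ℝ (Fin m)) M] [IsManifold (𝓡 m) ∞ M] where
  /-- the endomorphism of the fibre at `x` -/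
  map : ∀ x : M, BigTangent m x →ₗ[ℝ] BigTangent m x
  smooth : ∀ s, IsSmoothSection s → IsSmoothSection (fun x => map x (s x))
  map_map : ∀ x v, map x (map x v) = 0
  skew : ∀ x v w, g x v (map x w) + g x (map x v) w = 0
  const_rank : ∃ r : ℕ, ∀ x, Module.finrank ℝ (LinearMap.range (map x)) = r

namespace TwoNilpotent

variable (τ : TwoNilpotent m M)

/-- `τ` applied to a section. -/
def app (s : ∀ x : M, BigTangent m x) (x : M) : BigTangent m x := τ.map x (s x)

/-- The Courant-Nijenhuis torsion
`N(s, t) = [τ s, τ t] - τ[s, τ t] - τ[τ s, t] + τ²[s, t]`. -/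
def nijenhuis (s t : ∀ x : M, BigTangent m x) (x : M) : BigTangent m x :=
  courant (τ.app s) (τ.app t) x - τ.map x (courant s (τ.app t) x)
    - τ.map x (courant (τ.app s) t x) + τ.map x (τ.map x (courant s t x))

/-- `τ` is integrable: its Courant-Nijenhuis torsion vanishes. -/
def IsIntegrable : Prop :=
  ∀ s t : ∀ x : M, BigTangent m x, IsSmoothSection s → IsSmoothSection t →
    ∀ x, τ.nijenhuis s t x = 0

/-- The fibre at `x` of the image bundle `E = im τ`. -/
abbrev E (x : M) : Submodule ℝ (BigTangent m x) := LinearMap.range (τ.map x)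

/-- `τ` is weakly integrable: `E = im τ` is closed under Courant brackets. -/
def IsWeaklyIntegrable : Prop :=
  ∀ s t : ∀ x : M, BigTangent m x, IsSmoothSection s → IsSmoothSection t →
    (∀ x, s x ∈ τ.E x) → (∀ x, t x ∈ τ.E x) → ∀ x, courant s t x ∈ τ.E x

/-- Smooth sections of `E`. -/
def secE : Set (∀ x, τ.E x) := {e | IsSmoothSection (fun x => (e x : BigTangent m x))}

/-- The Courant bracket on sections of `E`. The dummy value `0` is never taken on smooth sections
when `τ` is weakly integrable. -/
def bracketE (e e' : ∀ x, τ.E x) (x : M) : τ.E x :=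
  open Classical in
  if h : courant (fun y => (e y : BigTangent m y)) (fun y => (e' y : BigTangent m y)) x ∈ τ.E x
  then ⟨_, h⟩ else 0

/-- The anchor `pr_{TM} : E → TM`. -/
def anchorE (x : M) : τ.E x →ₗ[ℝ] TangentSpace (𝓡 m) x :=
  LinearMap.fst ℝ _ _ ∘ₗ (τ.E x).subtype

/-! ### The dual bundle `E*` and the bivector field `Λ` -/

/-- The fibre at `x` of the dual bundle `E*`. -/
abbrev Edual (x : M) : Type := Module.Dual ℝ (τ.E x)

/-- The map `TM ⊕ T*M → E*` given by the `g`-pairing, `v ↦ g(v, ·)|_E`. It is onto, with kernel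
`E^⊥ = ker τ`, and identifies `(TM ⊕ T*M)/E^⊥` with `E*`. -/
def toDual (x : M) : BigTangent m x →ₗ[ℝ] τ.Edual x :=
  (τ.E x).subtype.dualMap ∘ₗ g x

theorem toDual_apply (x : M) (v : BigTangent m x) (e : τ.E x) : τ.toDual x v e = g x v e := rfl

theorem toDual_surjective (x : M) : Function.Surjective (τ.toDual x) :=
  restrict_surjective (τ.E x) (g x) (g_surjective x)

theorem toDual_eq_zero_iff (x : M) (v : BigTangent m x) : τ.toDual x v = 0 ↔ τ.map x v = 0 := by
  constructor
  · intro h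
    apply g_injective x
    refine LinearMap.ext fun w => ?_
    have h1 := LinearMap.congr_fun h ⟨τ.map x w, LinearMap.mem_range_self _ w⟩
    have h2 := τ.skew x v w
    rw [toDual_apply] at h1
    simp only [LinearMap.zero_apply] at h1
    rw [h1, zero_add] at h2
    simpa using h2
  · intro h
    ext ⟨_, w, rfl⟩
    have h2 := τ.skew x v w
    rw [h] at h2
    simpa [toDual_apply] using h2

/-- Smooth sections of `E*`, which are the images under `toDual` of the smooth sections of
`TM ⊕ T*M` (the map being a smooth surjective morphism of vector bundles). -/
def secDual : Set (∀ x, τ.Edual x) :=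
  {α | ∃ s, IsSmoothSection s ∧ ∀ x, α x = τ.toDual x (s x)}

/-- `♯_Λ : E* → E`, the isomorphism induced by `τ` on `E* = (TM ⊕ T*M)/E^⊥`, i.e. the class of `v`
is mapped to `τ v`. -/
def sharp (x : M) : τ.Edual x →ₗ[ℝ] τ.E x :=
  descend (D := τ.Edual x) (W := τ.E x) (τ.toDual x) (τ.toDual_surjective x) (τ.map x).rangeRestrict
    (fun v hv => Subtype.ext ((τ.toDual_eq_zero_iff x v).1 hv))

theorem sharp_toDual (x : M) (v : BigTangent m x) :
    (τ.sharp x (τ.toDual x v) : BigTangent m x) = τ.map x v := by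
  unfold sharp
  rw [descend_apply]
  rfl

/-- `♯_Λ` applied to a section of `E*`. -/
def sharpSec (α : ∀ x, τ.Edual x) (x : M) : τ.E x := τ.sharp x (α x)

/-- The bivector field `Λ` of `E`, `Λ(α, β) = β(♯_Λ α)`; on classes of `v`, `w` its value is
`g(τ v, w)`. -/
def bivector (α β : ∀ x, τ.Edual x) (x : M) : ℝ := β x (τ.sharpSec α x)

theorem bivector_toDual (s t : ∀ x : M, BigTangent m x) (x : M) :
    τ.bivector (fun y => τ.toDual y (s y)) (fun y => τ.toDual y (t y)) x =
      g x (τ.map x (s x)) (t x) := by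
  simp only [bivector, sharpSec, toDual_apply, sharp_toDual]
  simp only [g_apply]
  ring

/-! ### Calculus on the Lie algebroid `E` and the Gelfand-Dorfman bracket -/

/-- The derivative `ρ(e)(f)` of a function along a section of `E`. -/
def derivE (e : ∀ x, τ.E x) (f : M → ℝ) (x : M) : ℝ :=
  dirDeriv (fun y => τ.anchorE y (e y)) f x

/-- The differential `d_E f ∈ Γ(E*)` of a function, `(d_E f)(e) = ρ(e)(f)`. -/
def dE (f : M → ℝ) (x : M) : τ.Edual x :=
  (mvfderiv (𝓡 m) f x).toLinearMap ∘ₗ τ.anchorE x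

/-- The Lie derivative `L_e α ∈ Γ(E*)`: the unique element with
`(L_e α)(e') = ρ(e)(α(e')) - α([e, e'])` for all smooth sections `e'` of `E`. The right-hand side
is tensorial in `e'` for `e`, `α` smooth and `τ` weakly integrable; the dummy value `0` is not taken
then. -/
def lieDual (e : ∀ x, τ.E x) (α : ∀ x, τ.Edual x) (x : M) : τ.Edual x :=
  open Classical in
  if h : ∃ ξ : τ.Edual x, ∀ e' ∈ τ.secE,
      ξ (e' x) = τ.derivE e (fun y => α y (e' y)) x - α x (τ.bracketE e e' x)
  then h.choose else 0

/-- The Gelfand-Dorfman bracket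
`{α, β}_Λ = L_{♯α} β - L_{♯β} α - d_E(Λ(α, β))` on sections of `E*`. -/
def gelfandDorfman (α β : ∀ x, τ.Edual x) (x : M) : τ.Edual x :=
  τ.lieDual (τ.sharpSec α) β x - τ.lieDual (τ.sharpSec β) α x - τ.dE (τ.bivector α β) x

/-- The composition `E* → E → TM` of `♯_Λ` with the anchor of `E`. -/
def anchorDual (x : M) : τ.Edual x →ₗ[ℝ] TangentSpace (𝓡 m) x := τ.anchorE x ∘ₗ τ.sharp x

/-- `(E*, {,}_Λ, ♯_Λ)` is a Lie algebroid with anchor `♯_Λ : E* → E`, over the Lie algebroid `E`: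
`E*` with the bracket `{,}_Λ` and the composed anchor `E* → E → TM` satisfies the axioms of a Lie
algebroid, and the anchor `♯_Λ : E* → E` preserves the brackets. -/
structure IsDualLieAlgebroid : Prop where
  lieAlgebroid : IsLieAlgebroid τ.secDual τ.gelfandDorfman τ.anchorDual
  sharp_bracket : ∀ α ∈ τ.secDual, ∀ β ∈ τ.secDual, ∀ x,
    τ.sharp x (τ.gelfandDorfman α β x) = τ.bracketE (τ.sharpSec α) (τ.sharpSec β) x

/-! ### Triangular Lie bialgebroids -/

/-- The exterior differential `d_* : Γ(E) → Γ(∧²E)` defined by the bracket and the anchor of `E*`: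
`(d_* e)(α, β) = ρ_*(α)(β(e)) - ρ_*(β)(α(e)) - {α, β}(e)`. -/
def dStar (e : ∀ x, τ.E x) (α β : ∀ x, τ.Edual x) (x : M) : ℝ :=
  dirDeriv (fun y => τ.anchorDual y (α y)) (fun y => β y (e y)) x
    - dirDeriv (fun y => τ.anchorDual y (β y)) (fun y => α y (e y)) x
    - τ.gelfandDorfman α β x (e x)

/-- The Schouten bracket `[e, P] = L_e P` of a section of `E` and a section `P` of `∧²E`, seen as a
form on sections of `E*`: `(L_e P)(α, β) = ρ(e)(P(α, β)) - P(L_e α, β) - P(α, L_e β)`. -/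
def lieBivector (e : ∀ x, τ.E x) (P : (∀ x, τ.Edual x) → (∀ x, τ.Edual x) → M → ℝ)
    (α β : ∀ x, τ.Edual x) (x : M) : ℝ :=
  τ.derivE e (P α β) x - P (τ.lieDual e α) β x - P α (τ.lieDual e β) x

/-- The Schouten bracket `[Λ, Λ] ∈ Γ(∧³E)`, by its values
`[Λ, Λ](α, β, γ) = 2 ∑ (γ([♯α, ♯β]) - ρ(♯α)(Λ(β, γ)))`, the sum being over the cyclic permutations
of `α, β, γ`. -/
def schoutenSquare (α β γ : ∀ x, τ.Edual x) (x : M) : ℝ :=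
  2 * ((γ x (τ.bracketE (τ.sharpSec α) (τ.sharpSec β) x)
        - τ.derivE (τ.sharpSec α) (τ.bivector β γ) x)
      + (α x (τ.bracketE (τ.sharpSec β) (τ.sharpSec γ) x)
        - τ.derivE (τ.sharpSec β) (τ.bivector γ α) x)
      + (β x (τ.bracketE (τ.sharpSec γ) (τ.sharpSec α) x)
        - τ.derivE (τ.sharpSec γ) (τ.bivector α β) x))

/-- `(E, E*)` is a triangular Lie bialgebroid, `E` having the Courant bracket and the anchor
`pr_{TM}`, `E*` having the bracket `{,}_Λ` and the anchor `E* → E → TM`: both are Lie algebroids,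
`d_*[e, e'] = [d_* e, e'] + [e, d_* e']`, and the structure of `E*` comes from a bivector field `Λ`
with `[Λ, Λ] = 0`. -/
structure IsTriangularLieBialgebroid : Prop where
  lieAlgebroid : IsLieAlgebroid τ.secE τ.bracketE τ.anchorE
  lieAlgebroid_dual : IsLieAlgebroid τ.secDual τ.gelfandDorfman τ.anchorDual
  compatible : ∀ e ∈ τ.secE, ∀ e' ∈ τ.secE, ∀ α ∈ τ.secDual, ∀ β ∈ τ.secDual, ∀ x,
    τ.dStar (τ.bracketE e e') α β x =
      τ.lieBivector e (τ.dStar e') α β x - τ.lieBivector e' (τ.dStar e) α β x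
  schouten : ∀ α ∈ τ.secDual, ∀ β ∈ τ.secDual, ∀ γ ∈ τ.secDual, ∀ x,
    τ.schoutenSquare α β γ x = 0

end TwoNilpotent

end GenGeom

end

/-!
Unlike the Courant bracket, the Dorfman bracket `s ∘ t` satisfies the Leibniz identity and acts by
derivations of `g`; on orthogonal sections the two brackets agree. Hence the Courant bracket makes
the isotropic bundle `E = im τ` a Lie algebroid, and the Lie derivative `L_e` on
`E* = (TM ⊕ T*M)/E^⊥` is induced by `e ∘ _`. The Gelfand-Dorfman bracket of the classes of `s` and
`t` is then the class of `s ∘ τ t + τ s ∘ t`, so that the torsion of `τ` is the defect of `♯_Λ` to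
preserve the brackets. If this defect vanishes, `E*` inherits the Lie algebroid axioms from `E`
along the injective map `♯_Λ`. Independently of integrability, `d_* e = -L_e Λ`, which makes `d_*` a
derivation of the bracket of `E` because `L` represents `E`. Finally `[Λ, Λ](α, β, γ)` is twice the
pairing of `γ` with the defect of `♯_Λ` on `α` and `β`.
-/

noncomputable section

namespace GenGeom

open VectorField

section Extension

variable {E H M F : Type*} [NormedAddCommGroup E] [NormedSpace ℝ E] [FiniteDimensional ℝ E]
  [TopologicalSpace H] (I : ModelWithCorners ℝ E H) [TopologicalSpace M] [ChartedSpace H M]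
  [IsManifold I ∞ M] [T2Space M] [NormedAddCommGroup F] [NormedSpace ℝ F] {V : M → Type*}
  [∀ x, AddCommGroup (V x)] [∀ x, Module ℝ (V x)] [∀ x, TopologicalSpace (V x)]
  [TopologicalSpace (Bundle.TotalSpace F V)] [FiberBundle F V] [VectorBundle ℝ F V]

theorem exists_contMDiff_section_eventuallyEq {x : M} {U : Set M} (hU : IsOpen U) (hx : x ∈ U)
    {W : ∀ x : M, V x}
    (hW : ContMDiffOn I (I.prod 𝓘(ℝ, F)) ∞ (fun y => Bundle.TotalSpace.mk' F y (W y)) U) :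
    ∃ Z : ∀ x : M, V x,
      ContMDiff I (I.prod 𝓘(ℝ, F)) ∞ (fun y => Bundle.TotalSpace.mk' F y (Z y)) ∧
      ∀ᶠ y in nhds x, Z y = W y := by
  obtain ⟨ψ, -, hψ⟩ := (SmoothBumpFunction.nhds_basis_tsupport (I := I) x).mem_iff.1
    (hU.mem_nhds hx)
  refine ⟨fun y => ψ y • W y,
    ContMDiffOn.smul_section_of_tsupport ψ.contMDiff.contMDiffOn hU hψ hW, ?_⟩
  filter_upwards [ψ.eventuallyEq_one] with y hy
  rw [hy, Pi.one_apply, one_smul]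

theorem exists_contMDiff_section_eq [ContMDiffVectorBundle ∞ F V I] {x : M} (v : V x) :
    ∃ Z : ∀ x : M, V x,
      ContMDiff I (I.prod 𝓘(ℝ, F)) ∞ (fun y => Bundle.TotalSpace.mk' F y (Z y)) ∧ Z x = v := by
  obtain ⟨s, hs, hW⟩ := FiberBundle.exists_contMDiffOn_extend I F (k := ∞) v
  obtain ⟨U, hUs, hU, hx⟩ := mem_nhds_iff.1 hs
  obtain ⟨Z, hZ, hZW⟩ := exists_contMDiff_section_eventuallyEq I hU hx (hW.mono hUs)
  exact ⟨Z, hZ, hZW.self_of_nhds.trans (by simp)⟩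

end Extension

variable {m : ℕ} {M : Type*} [TopologicalSpace M] [ChartedSpace (EuclideanSpace ℝ (Fin m)) M]

section Functions

variable {f h : M → ℝ}

theorem IsSmoothFun.mdifferentiableAt (hf : IsSmoothFun m f) (x : M) :
    MDifferentiableAt (𝓡 m) 𝓘(ℝ, ℝ) f x :=
  (hf x).mdifferentiableAt (by simp)

theorem IsSmoothFun.add (hf : IsSmoothFun m f) (hh : IsSmoothFun m h) :
    IsSmoothFun m (fun x => f x + h x) := ContMDiff.add hf hh

theorem IsSmoothFun.sub (hf : IsSmoothFun m f) (hh : IsSmoothFun m h) :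
    IsSmoothFun m (fun x => f x - h x) := ContMDiff.sub hf hh

theorem IsSmoothFun.mul (hf : IsSmoothFun m f) (hh : IsSmoothFun m h) :
    IsSmoothFun m (fun x => f x * h x) := ContMDiff.mul hf hh

theorem dirDeriv_const (X : ∀ x : M, TangentSpace (𝓡 m) x) (c : ℝ) (x : M) :
    dirDeriv X (fun _ => c) x = 0 := by
  rw [dirDeriv, mvfderiv_const]
  rfl

theorem dirDeriv_neg (X : ∀ x : M, TangentSpace (𝓡 m) x) (f : M → ℝ) (x : M) :
    dirDeriv X (fun y => -f y) x = -dirDeriv X f x := by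
  rw [dirDeriv, mvfderiv_fun_neg]
  rfl

variable (X : ∀ x : M, TangentSpace (𝓡 m) x)

theorem dirDeriv_add (hf : IsSmoothFun m f) (hh : IsSmoothFun m h) (x : M) :
    dirDeriv X (fun y => f y + h y) x = dirDeriv X f x + dirDeriv X h x := by
  rw [dirDeriv, mvfderiv_fun_add (hf.mdifferentiableAt x) (hh.mdifferentiableAt x)]
  rfl

theorem dirDeriv_sub (hf : IsSmoothFun m f) (hh : IsSmoothFun m h) (x : M) :
    dirDeriv X (fun y => f y - h y) x = dirDeriv X f x - dirDeriv X h x := by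
  rw [dirDeriv, mvfderiv_fun_sub (hf.mdifferentiableAt x) (hh.mdifferentiableAt x)]
  rfl

theorem dirDeriv_mul (hf : IsSmoothFun m f) (hh : IsSmoothFun m h) (x : M) :
    dirDeriv X (fun y => f y * h y) x = f x * dirDeriv X h x + h x * dirDeriv X f x := by
  rw [dirDeriv, mvfderiv_fun_mul (hf.mdifferentiableAt x) (hh.mdifferentiableAt x)]
  rfl

end Functions

/-! ### Vector fields and 1-forms -/

section VectorFields

variable [IsManifold (𝓡 m) ∞ M] {f : M → ℝ} {X Y Z : ∀ x : M, TangentSpace (𝓡 m) x}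
  {α β : ∀ x : M, Cotangent m x}

theorem IsSmoothVectorField.mdifferentiableAt (hX : IsSmoothVectorField X) (x : M) :
    MDifferentiableAt (𝓡 m) (𝓡 m).tangent (fun y => (⟨y, X y⟩ : TangentBundle (𝓡 m) M)) x :=
  (hX x).mdifferentiableAt (by simp)

theorem IsSmoothVectorField.add (hX : IsSmoothVectorField X) (hY : IsSmoothVectorField Y) :
    IsSmoothVectorField (fun x => X x + Y x) := ContMDiff.add_section hX hY

theorem IsSmoothVectorField.smul (hf : IsSmoothFun m f) (hX : IsSmoothVectorField X) :
    IsSmoothVectorField (fun x => f x • X x) := ContMDiff.smul_section hf hX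

theorem IsSmoothVectorField.mlieBracket (hX : IsSmoothVectorField X)
    (hY : IsSmoothVectorField Y) :
    IsSmoothVectorField (VectorField.mlieBracket (𝓡 m) X Y) := by
  have : IsManifold (𝓡 m) (((⊤ : ℕ∞) : WithTop ℕ∞) + 1) M :=
    inferInstanceAs (IsManifold (𝓡 m) ∞ M)
  have : IsManifold (𝓡 m) (minSmoothness ℝ 2) M :=
    .of_le (n := ∞) (by simp [minSmoothness_of_isRCLikeNormedField, ENat.LEInfty.out])
  exact ContDiff.mlieBracket_vectorField (m := (⊤ : ℕ∞)) (n := (⊤ : ℕ∞)) hX hY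
    (by simp [minSmoothness_of_isRCLikeNormedField])

theorem mlieBracket_fun_smul_right (X : ∀ x : M, TangentSpace (𝓡 m) x) (hf : IsSmoothFun m f)
    (hY : IsSmoothVectorField Y) (x : M) :
    mlieBracket (𝓡 m) X (fun y => f y • Y y) x =
      dirDeriv X f x • Y x + f x • mlieBracket (𝓡 m) X Y x :=
  mlieBracket_smul_right (hf.mdifferentiableAt x) (hY.mdifferentiableAt x)

theorem IsSmoothVectorField.leibniz_mlieBracket (hX : IsSmoothVectorField X)
    (hY : IsSmoothVectorField Y) (hZ : IsSmoothVectorField Z) (x : M) :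
    VectorField.mlieBracket (𝓡 m) X (VectorField.mlieBracket (𝓡 m) Y Z) x =
      VectorField.mlieBracket (𝓡 m) (VectorField.mlieBracket (𝓡 m) X Y) Z x
        + VectorField.mlieBracket (𝓡 m) Y (VectorField.mlieBracket (𝓡 m) X Z) x := by
  have h2 : minSmoothness ℝ 2 ≤ (∞ : WithTop ℕ∞) := by
    simp [minSmoothness_of_isRCLikeNormedField, ENat.LEInfty.out]
  have : IsManifold (𝓡 m) (minSmoothness ℝ 3) M :=
    .of_le (n := ∞) (by simp [minSmoothness_of_isRCLikeNormedField, ENat.LEInfty.out])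
  exact leibniz_identity_mlieBracket_apply ((hX x).of_le h2) ((hY x).of_le h2) ((hZ x).of_le h2)

theorem IsSmoothFun.dirDeriv (hX : IsSmoothVectorField X) (hf : IsSmoothFun m f) :
    IsSmoothFun m (dirDeriv X f) := by
  have hdf : ContMDiff (𝓡 m).tangent 𝓘(ℝ, ℝ).tangent ∞ (tangentMap (𝓡 m) 𝓘(ℝ, ℝ) f) :=
    ContMDiff.contMDiff_tangentMap (n := ∞) hf (by simp)
  exact (contMDiff_snd_tangentBundle_modelSpace ℝ 𝓘(ℝ, ℝ)).comp (hdf.comp hX)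

theorem mlieBracket_mlieBracket_fun_smul_right (X : ∀ x : M, TangentSpace (𝓡 m) x)
    (hY : IsSmoothVectorField Y) (hf : IsSmoothFun m f) (hZ : IsSmoothVectorField Z) (x : M) :
    mlieBracket (𝓡 m) X (mlieBracket (𝓡 m) Y fun y => f y • Z y) x =
      dirDeriv X (dirDeriv Y f) x • Z x + dirDeriv Y f x • mlieBracket (𝓡 m) X Z x
        + (dirDeriv X f x • mlieBracket (𝓡 m) Y Z x
          + f x • mlieBracket (𝓡 m) X (mlieBracket (𝓡 m) Y Z) x) := by
  rw [show mlieBracket (𝓡 m) Y (fun y => f y • Z y) =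
      (fun y => dirDeriv Y f y • Z y) + fun y => f y • mlieBracket (𝓡 m) Y Z y from
    funext (mlieBracket_fun_smul_right Y hf hZ), mlieBracket_add_right
      ((IsSmoothVectorField.smul (hf.dirDeriv hY) hZ).mdifferentiableAt x)
      ((IsSmoothVectorField.smul hf (hY.mlieBracket hZ)).mdifferentiableAt x),
    mlieBracket_fun_smul_right X (hf.dirDeriv hY) hZ,
    mlieBracket_fun_smul_right X hf (hY.mlieBracket hZ)]

theorem IsSmoothOneForm.apply (hα : IsSmoothOneForm α) (hX : IsSmoothVectorField X) :
    IsSmoothFun m (fun x => α x (X x)) := fun x =>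
  (Bundle.contMDiffAt_section _).1 <|
    ContMDiff.clm_bundle_apply (E₂ := fun y : M => Bundle.Trivial M ℝ y) (F₂ := ℝ) hα hX x

section Local

variable [T2Space M]

theorem exists_isSmoothVectorField_eq {x : M} (v : TangentSpace (𝓡 m) x) :
    ∃ Z : ∀ x : M, TangentSpace (𝓡 m) x, IsSmoothVectorField Z ∧ Z x = v :=
  exists_contMDiff_section_eq (𝓡 m) v

theorem exists_isSmoothOneForm_eq {x : M} (φ : Cotangent m x) :
    ∃ α : ∀ x : M, Cotangent m x, IsSmoothOneForm α ∧ α x = φ :=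
  exists_contMDiff_section_eq (𝓡 m) (F := EuclideanSpace ℝ (Fin m) →L[ℝ] ℝ)
    (V := fun x : M => TangentSpace (𝓡 m) x →L[ℝ] Bundle.Trivial M ℝ x) φ

theorem cotangent_ext {x : M} {φ ψ : Cotangent m x}
    (h : ∀ Z : ∀ x : M, TangentSpace (𝓡 m) x, IsSmoothVectorField Z → φ (Z x) = ψ (Z x)) :
    φ = ψ := by
  ext v
  obtain ⟨Z, hZ, rfl⟩ := exists_isSmoothVectorField_eq v
  exact h Z hZ

theorem isSmoothOneForm_of_apply
    (h : ∀ Z : ∀ x : M, TangentSpace (𝓡 m) x, IsSmoothVectorField Z →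
      IsSmoothFun m (fun x => α x (Z x))) : IsSmoothOneForm α := by
  intro x
  rw [contMDiffAt_hom_bundle]
  refine ⟨contMDiffAt_id, ?_⟩
  set e := trivializationAt (EuclideanSpace ℝ (Fin m)) (TangentSpace (𝓡 m) : M → Type) x
  set b := (EuclideanSpace.basisFun (Fin m) ℝ).toBasis with hb
  have hx : x ∈ e.baseSet := FiberBundle.mem_baseSet_trivializationAt' x
  choose Z hZ hZe using fun i => exists_contMDiff_section_eventuallyEq (𝓡 m) e.open_baseSet hx
    (e.contMDiffOn_localFrame_baseSet ∞ b i)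
  -- In the trivialization `e`, the coordinates of `α` are its values on the local frame of `e`.
  have hcoord : ContMDiffAt (𝓡 m) 𝓘(ℝ, EuclideanSpace ℝ (Fin m) →L[ℝ] ℝ) ∞
      (fun y => ∑ i, α y (Z i y) • (EuclideanSpace.proj i : EuclideanSpace ℝ (Fin m) →L[ℝ] ℝ)) x :=
    contMDiffAt_finsetSum fun i _ => (h (Z i) (hZ i) x).smul contMDiffAt_const
  refine hcoord.congr_of_eventuallyEq ?_
  filter_upwards [Filter.eventually_all.2 hZe, e.open_baseSet.mem_nhds hx] with y hy hye
  rw [ContinuousLinearMap.inCoordinates_eq hye (by simp)]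
  refine ContinuousLinearMap.coe_injective (b.ext fun i => ?_)
  rw [ContinuousLinearMap.coe_coe, ContinuousLinearMap.coe_coe]
  simp only [hy, e.localFrame_apply_of_mem_baseSet b hye]
  simp [hb, Bundle.Trivialization.basisAt]
  rfl

theorem IsSmoothOneForm.add (hα : IsSmoothOneForm α) (hβ : IsSmoothOneForm β) :
    IsSmoothOneForm (fun x => α x + β x) :=
  isSmoothOneForm_of_apply fun _ hZ => (hα.apply hZ).add (hβ.apply hZ)

theorem IsSmoothOneForm.sub (hα : IsSmoothOneForm α) (hβ : IsSmoothOneForm β) :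
    IsSmoothOneForm (fun x => α x - β x) :=
  isSmoothOneForm_of_apply fun _ hZ => (hα.apply hZ).sub (hβ.apply hZ)

theorem IsSmoothOneForm.smul (hf : IsSmoothFun m f) (hα : IsSmoothOneForm α) :
    IsSmoothOneForm (fun x => f x • α x) :=
  isSmoothOneForm_of_apply fun _ hZ => hf.mul (hα.apply hZ)

theorem IsSmoothFun.mvfderiv (hf : IsSmoothFun m f) : IsSmoothOneForm (mvfderiv (𝓡 m) f) :=
  isSmoothOneForm_of_apply fun _ hZ => hf.dirDeriv hZ

theorem IsSmoothOneForm.lieForm (hX : IsSmoothVectorField X) (hα : IsSmoothOneForm α) :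
    IsSmoothOneForm (lieForm X α) := by
  refine isSmoothOneForm_of_apply fun Z hZ => ?_
  simp only [lieForm_apply hα hZ]
  exact ((hα.apply hZ).dirDeriv hX).sub (hα.apply (hX.mlieBracket hZ))

theorem dirDeriv_mlieBracket (hX : IsSmoothVectorField X) (hY : IsSmoothVectorField Y)
    (hf : IsSmoothFun m f) (x : M) :
    dirDeriv (mlieBracket (𝓡 m) X Y) f x =
      dirDeriv X (dirDeriv Y f) x - dirDeriv Y (dirDeriv X f) x := by
  rcases subsingleton_or_nontrivial (TangentSpace (𝓡 m) x) with _ | _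
  · simp [dirDeriv, Subsingleton.elim (_ : TangentSpace (𝓡 m) x) 0]
  obtain ⟨v, hv⟩ := exists_ne (0 : TangentSpace (𝓡 m) x)
  obtain ⟨Z, hZ, rfl⟩ := exists_isSmoothVectorField_eq v
  -- Compare the coefficients of `Z` in the Jacobi identity for `X`, `Y` and `f • Z`.
  have jacobi := hX.leibniz_mlieBracket hY (IsSmoothVectorField.smul hf hZ) x
  rw [mlieBracket_mlieBracket_fun_smul_right X hY hf hZ,
    mlieBracket_mlieBracket_fun_smul_right Y hX hf hZ, mlieBracket_fun_smul_right _ hf hZ,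
    hX.leibniz_mlieBracket hY hZ] at jacobi
  refine smul_left_injective ℝ hv (?_ : _ • Z x = _ • Z x)
  linear_combination (norm := module) -jacobi

end Local

/-! ### Cartan calculus of 1-forms -/

/-- The contraction `ι_X dα` of the exterior differential of a 1-form with a vector field, defined
through Cartan's formula `L_X α = ι_X dα + d(α(X))`. -/
def contractExtDeriv (X : ∀ x : M, TangentSpace (𝓡 m) x) (α : ∀ x : M, Cotangent m x) (x : M) :
    Cotangent m x :=
  lieForm X α x - mvfderiv (𝓡 m) (fun y => α y (X y)) x

theorem contractExtDeriv_apply (X : ∀ x : M, TangentSpace (𝓡 m) x) (hα : IsSmoothOneForm α)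
    (hZ : IsSmoothVectorField Z) (x : M) :
    contractExtDeriv X α x (Z x) =
      dirDeriv X (fun y => α y (Z y)) x - dirDeriv Z (fun y => α y (X y)) x
        - α x (mlieBracket (𝓡 m) X Z x) := by
  rw [contractExtDeriv, sub_apply, lieForm_apply hα hZ, sub_right_comm]
  rfl

theorem contractExtDeriv_swap (hα : IsSmoothOneForm α) (hX : IsSmoothVectorField X)
    (hZ : IsSmoothVectorField Z) (x : M) :
    contractExtDeriv X α x (Z x) = -contractExtDeriv Z α x (X x) := by
  rw [contractExtDeriv_apply X hα hZ, contractExtDeriv_apply Z hα hX,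
    mlieBracket_swap_apply (V := X), map_neg]
  ring

section Cartan

variable [T2Space M]

theorem IsSmoothOneForm.contractExtDeriv (hX : IsSmoothVectorField X) (hα : IsSmoothOneForm α) :
    IsSmoothOneForm (contractExtDeriv X α) :=
  (hα.lieForm hX).sub (hα.apply hX).mvfderiv

theorem lieForm_mvfderiv (hX : IsSmoothVectorField X) (hf : IsSmoothFun m f) (x : M) :
    lieForm X (mvfderiv (𝓡 m) f) x = mvfderiv (𝓡 m) (dirDeriv X f) x := by
  refine cotangent_ext fun Z hZ => ?_
  rw [lieForm_apply hf.mvfderiv hZ]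
  change dirDeriv X (dirDeriv Z f) x - dirDeriv (mlieBracket (𝓡 m) X Z) f x =
    dirDeriv Z (dirDeriv X f) x
  rw [dirDeriv_mlieBracket hX hZ hf, sub_sub_cancel]

theorem lieForm_sub (X : ∀ x : M, TangentSpace (𝓡 m) x) (hα : IsSmoothOneForm α)
    (hβ : IsSmoothOneForm β) (x : M) :
    lieForm X (fun y => α y - β y) x = lieForm X α x - lieForm X β x := by
  refine cotangent_ext fun Z hZ => ?_
  simp only [sub_apply, lieForm_apply hα hZ, lieForm_apply hβ hZ,
    lieForm_apply (hα.sub hβ) hZ, dirDeriv_sub X (hα.apply hZ) (hβ.apply hZ)]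
  ring

theorem lieForm_mlieBracket (hX : IsSmoothVectorField X) (hY : IsSmoothVectorField Y)
    (hα : IsSmoothOneForm α) (x : M) :
    lieForm (mlieBracket (𝓡 m) X Y) α x =
      lieForm X (lieForm Y α) x - lieForm Y (lieForm X α) x := by
  refine cotangent_ext fun Z hZ => ?_
  have iterate : ∀ {U V : ∀ x : M, TangentSpace (𝓡 m) x}, IsSmoothVectorField U →
      IsSmoothVectorField V → lieForm U (lieForm V α) x (Z x) =
        dirDeriv U (dirDeriv V fun y => α y (Z y)) x
          - dirDeriv U (fun y => α y (mlieBracket (𝓡 m) V Z y)) x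
          - (dirDeriv V (fun y => α y (mlieBracket (𝓡 m) U Z y)) x
            - α x (mlieBracket (𝓡 m) V (mlieBracket (𝓡 m) U Z) x)) := by
    intro U V hU hV
    rw [lieForm_apply (hα.lieForm hV) hZ, lieForm_apply hα (hU.mlieBracket hZ),
      ← dirDeriv_sub U ((hα.apply hZ).dirDeriv hV) (hα.apply (hV.mlieBracket hZ))]
    simp only [lieForm_apply hα hZ]
  rw [sub_apply, iterate hX hY, iterate hY hX, lieForm_apply hα hZ,
    dirDeriv_mlieBracket hX hY (hα.apply hZ), hX.leibniz_mlieBracket hY hZ, map_add]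
  ring

theorem contractExtDeriv_mvfderiv (hX : IsSmoothVectorField X) (hf : IsSmoothFun m f) (x : M) :
    contractExtDeriv X (mvfderiv (𝓡 m) f) x = 0 :=
  sub_eq_zero.2 (lieForm_mvfderiv hX hf x)

theorem contractExtDeriv_sub (hX : IsSmoothVectorField X) (hα : IsSmoothOneForm α)
    (hβ : IsSmoothOneForm β) (x : M) :
    contractExtDeriv X (fun y => α y - β y) x =
      contractExtDeriv X α x - contractExtDeriv X β x := by
  simp only [contractExtDeriv, lieForm_sub X hα hβ, sub_apply]
  rw [mvfderiv_fun_sub ((hα.apply hX).mdifferentiableAt x) ((hβ.apply hX).mdifferentiableAt x)]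
  abel

theorem contractExtDeriv_contractExtDeriv (hX : IsSmoothVectorField X)
    (hY : IsSmoothVectorField Y) (hα : IsSmoothOneForm α) (x : M) :
    contractExtDeriv X (contractExtDeriv Y α) x = contractExtDeriv X (lieForm Y α) x := by
  have h := contractExtDeriv_sub hX (hα.lieForm hY) (hα.apply hY).mvfderiv x
  rwa [contractExtDeriv_mvfderiv hX (hα.apply hY), sub_zero] at h

theorem lieForm_contractExtDeriv (hX : IsSmoothVectorField X) (hY : IsSmoothVectorField Y)
    (hα : IsSmoothOneForm α) (x : M) :
    lieForm X (contractExtDeriv Y α) x =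
      contractExtDeriv (mlieBracket (𝓡 m) X Y) α x + contractExtDeriv Y (lieForm X α) x := by
  have hd : mvfderiv (𝓡 m) (dirDeriv X fun y => α y (Y y)) x =
      mvfderiv (𝓡 m) (fun y => lieForm X α y (Y y)) x
        + mvfderiv (𝓡 m) (fun y => α y (mlieBracket (𝓡 m) X Y y)) x := by
    rw [← mvfderiv_fun_add (((hα.lieForm hX).apply hY).mdifferentiableAt x)
      ((hα.apply (hX.mlieBracket hY)).mdifferentiableAt x)]
    simp only [lieForm_apply hα hY, sub_add_cancel]
  have h := lieForm_sub X (hα.lieForm hY) (hα.apply hY).mvfderiv x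
  rw [lieForm_mvfderiv hX (hα.apply hY), hd] at h
  rw [contractExtDeriv, contractExtDeriv, lieForm_mlieBracket hX hY hα]
  refine h.trans ?_
  abel

end Cartan

end VectorFields

/-! ### The Dorfman bracket -/

theorem g_comm (x : M) (v w : BigTangent m x) : g x v w = g x w v := by
  rw [g_apply, g_apply, add_comm]

/-- The gradient `(0, df)` of a function for the neutral metric `g`. -/
def gradient (f : M → ℝ) (x : M) : BigTangent m x := (0, mvfderiv (𝓡 m) f x)

theorem g_gradient (f : M → ℝ) (x : M) (v : BigTangent m x) :
    g x (gradient f x) v = mvfderiv (𝓡 m) f x v.1 := by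
  simp [g_apply, gradient]

theorem gradient_zero (x : M) : gradient (m := m) (fun _ => 0) x = 0 := by
  rw [gradient, mvfderiv_const]
  rfl

theorem gradient_neg (f : M → ℝ) (x : M) :
    gradient (m := m) (fun y => -f y) x = -gradient (m := m) f x := by
  simp [gradient, mvfderiv_fun_neg]

variable [IsManifold (𝓡 m) ∞ M] {f : M → ℝ} {s t u : ∀ x : M, BigTangent m x}

/-- The Dorfman bracket `(X, α) ∘ (Y, μ) = ([X, Y], L_X μ - ι_Y dα)`, whose skew-symmetric part is
the Courant bracket. Unlike the latter it satisfies the Leibniz form of the Jacobi identity and acts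
by derivations of `g`. -/
def dorfman (s t : ∀ x : M, BigTangent m x) (x : M) : BigTangent m x :=
  (mlieBracket (𝓡 m) (fun y => (s y).1) (fun y => (t y).1) x,
    lieForm (fun y => (s y).1) (fun y => (t y).2) x
      - contractExtDeriv (fun y => (t y).1) (fun y => (s y).2) x)

theorem IsSmoothSection.g (hs : IsSmoothSection s) (ht : IsSmoothSection t) :
    IsSmoothFun m (fun x => g x (s x) (t x)) :=
  (hs.2.apply ht.1).add (ht.2.apply hs.1)

theorem mvfderiv_g (hs : IsSmoothSection s) (ht : IsSmoothSection t) (x : M) :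
    mvfderiv (𝓡 m) (fun y => g y (s y) (t y)) x =
      mvfderiv (𝓡 m) (fun y => (s y).2 (t y).1) x
        + mvfderiv (𝓡 m) (fun y => (t y).2 (s y).1) x :=
  mvfderiv_fun_add ((hs.2.apply ht.1).mdifferentiableAt x) ((ht.2.apply hs.1).mdifferentiableAt x)

theorem courant_eq_dorfman_sub (hs : IsSmoothSection s) (ht : IsSmoothSection t) (x : M) :
    courant s t x = dorfman s t x - (1 / 2 : ℝ) • gradient (fun y => g y (s y) (t y)) x := by
  refine Prod.ext (by simp [courant, dorfman, gradient]) ?_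
  simp only [courant, dorfman, gradient, contractExtDeriv, Prod.snd_sub, Prod.smul_snd]
  rw [mvfderiv_g hs ht, mvfderiv_fun_sub ((hs.2.apply ht.1).mdifferentiableAt x)
    ((ht.2.apply hs.1).mdifferentiableAt x)]
  module

theorem dorfman_add_swap (hs : IsSmoothSection s) (ht : IsSmoothSection t) (x : M) :
    dorfman s t x + dorfman t s x = gradient (fun y => g y (s y) (t y)) x := by
  refine Prod.ext ?_ ?_
  · simp only [dorfman, gradient, Prod.fst_add]
    rw [mlieBracket_swap_apply, neg_add_cancel]
  · simp only [dorfman, gradient, contractExtDeriv, Prod.snd_add]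
    rw [mvfderiv_g hs ht]
    abel

theorem dorfman_swap_of_orthogonal (hs : IsSmoothSection s) (ht : IsSmoothSection t)
    (h : ∀ x, g x (s x) (t x) = 0) (x : M) : dorfman s t x = -dorfman t s x := by
  refine eq_neg_of_add_eq_zero_left ?_
  rw [dorfman_add_swap hs ht, funext h, gradient_zero]

theorem courant_eq_dorfman_of_orthogonal (hs : IsSmoothSection s) (ht : IsSmoothSection t)
    (h : ∀ x, g x (s x) (t x) = 0) (x : M) : courant s t x = dorfman s t x := by
  rw [courant_eq_dorfman_sub hs ht, funext h, gradient_zero, smul_zero, sub_zero]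

theorem dirDeriv_g (hs : IsSmoothSection s) (ht : IsSmoothSection t) (hu : IsSmoothSection u)
    (x : M) :
    dirDeriv (fun y => (s y).1) (fun y => g y (t y) (u y)) x =
      g x (dorfman s t x) (u x) + g x (t x) (dorfman s u x) := by
  have contract_swap := contractExtDeriv_swap hs.2 ht.1 hu.1 x
  simp only [g_apply, dorfman, sub_apply]
  rw [dirDeriv_add _ (ht.2.apply hu.1) (hu.2.apply ht.1), lieForm_apply ht.2 hu.1,
    lieForm_apply hu.2 ht.1]
  linarith

section Leibniz

variable [T2Space M]

theorem exists_isSmoothSection_eq {x : M} (v : BigTangent m x) :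
    ∃ s : ∀ x : M, BigTangent m x, IsSmoothSection s ∧ s x = v := by
  obtain ⟨X, hX, hXv⟩ := exists_isSmoothVectorField_eq v.1
  obtain ⟨α, hα, hαv⟩ := exists_isSmoothOneForm_eq v.2
  exact ⟨fun y => (X y, α y), ⟨hX, hα⟩, Prod.ext hXv hαv⟩

theorem bigTangent_ext {x : M} {v w : BigTangent m x}
    (h : ∀ s : ∀ x : M, BigTangent m x, IsSmoothSection s → g x v (s x) = g x w (s x)) :
    v = w := by
  refine g_injective x (LinearMap.ext fun z => ?_)
  obtain ⟨s, hs, rfl⟩ := exists_isSmoothSection_eq z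
  exact h s hs

theorem IsSmoothSection.add (hs : IsSmoothSection s) (ht : IsSmoothSection t) :
    IsSmoothSection (fun x => s x + t x) :=
  ⟨hs.1.add ht.1, hs.2.add ht.2⟩

theorem IsSmoothSection.smul (hf : IsSmoothFun m f) (hs : IsSmoothSection s) :
    IsSmoothSection (fun x => f x • s x) :=
  ⟨.smul hf hs.1, .smul hf hs.2⟩

theorem IsSmoothSection.dorfman (hs : IsSmoothSection s) (ht : IsSmoothSection t) :
    IsSmoothSection (dorfman s t) :=
  ⟨hs.1.mlieBracket ht.1, (ht.2.lieForm hs.1).sub (hs.2.contractExtDeriv ht.1)⟩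

theorem dorfman_add_right (hs : IsSmoothSection s) (ht : IsSmoothSection t)
    (hu : IsSmoothSection u) (x : M) :
    dorfman s (fun y => t y + u y) x = dorfman s t x + dorfman s u x := by
  refine bigTangent_ext fun v hv => ?_
  have h := dirDeriv_g hs (ht.add hu) hv x
  simp only [map_add, LinearMap.add_apply] at h ⊢
  rw [dirDeriv_add _ (ht.g hv) (hu.g hv), dirDeriv_g hs ht hv, dirDeriv_g hs hu hv] at h
  linarith

theorem dorfman_smul_right (hs : IsSmoothSection s) (hf : IsSmoothFun m f)
    (ht : IsSmoothSection t) (x : M) :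
    dorfman s (fun y => f y • t y) x =
      f x • dorfman s t x + dirDeriv (fun y => (s y).1) f x • t x := by
  refine bigTangent_ext fun v hv => ?_
  have h := dirDeriv_g hs (ht.smul hf) hv x
  simp only [map_add, map_smul, LinearMap.add_apply, LinearMap.smul_apply, smul_eq_mul] at h ⊢
  rw [dirDeriv_mul _ hf (ht.g hv), dirDeriv_g hs ht hv] at h
  linarith

theorem dorfman_leibniz (hs : IsSmoothSection s) (ht : IsSmoothSection t)
    (hu : IsSmoothSection u) (x : M) :
    dorfman s (dorfman t u) x = dorfman (dorfman s t) u x + dorfman t (dorfman s u) x := by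
  refine Prod.ext (hs.1.leibniz_mlieBracket ht.1 hu.1 x) ?_
  simp only [dorfman, Prod.snd_add]
  rw [lieForm_sub _ (hu.2.lieForm ht.1) (ht.2.contractExtDeriv hu.1),
    lieForm_sub _ (hu.2.lieForm hs.1) (hs.2.contractExtDeriv hu.1),
    contractExtDeriv_sub hu.1 (ht.2.lieForm hs.1) (hs.2.contractExtDeriv ht.1),
    contractExtDeriv_contractExtDeriv hu.1 ht.1 hs.2, lieForm_contractExtDeriv hs.1 hu.1 ht.2,
    lieForm_contractExtDeriv ht.1 hu.1 hs.2, lieForm_mlieBracket hs.1 ht.1 hu.2]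
  abel

end Leibniz

/-! ### Lie algebroids -/

section LieAlgebroid

variable {V : M → Type*} [∀ x, AddCommGroup (V x)] [∀ x, Module ℝ (V x)] {Γ : Set (∀ x, V x)}
  {bracket : (∀ x, V x) → (∀ x, V x) → ∀ x, V x} {ρ : ∀ x, V x →ₗ[ℝ] TangentSpace (𝓡 m) x}

theorem IsLieAlgebroid.of_leibniz (add_mem : ∀ a ∈ Γ, ∀ b ∈ Γ, a + b ∈ Γ)
    (smul_mem : ∀ r : ℝ, ∀ a ∈ Γ, r • a ∈ Γ) (bracket_mem : ∀ a ∈ Γ, ∀ b ∈ Γ, bracket a b ∈ Γ)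
    (anchor_smooth : ∀ a ∈ Γ, IsSmoothVectorField (fun x => ρ x (a x)))
    (skew : ∀ a ∈ Γ, ∀ b ∈ Γ, ∀ x, bracket a b x = -bracket b a x)
    (add_right : ∀ a ∈ Γ, ∀ b ∈ Γ, ∀ c ∈ Γ, ∀ x,
      bracket a (b + c) x = bracket a b x + bracket a c x)
    (leibniz : ∀ f : M → ℝ, IsSmoothFun m f → ∀ a ∈ Γ, ∀ b ∈ Γ, ∀ x,
      bracket a (fun y => f y • b y) x =
        f x • bracket a b x + dirDeriv (fun y => ρ y (a y)) f x • b x)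
    (derivation : ∀ a ∈ Γ, ∀ b ∈ Γ, ∀ c ∈ Γ, ∀ x,
      bracket a (bracket b c) x = bracket (bracket a b) c x + bracket b (bracket a c) x)
    (anchor_bracket : ∀ a ∈ Γ, ∀ b ∈ Γ, ∀ x, ρ x (bracket a b x) =
      mlieBracket (𝓡 m) (fun y => ρ y (a y)) (fun y => ρ y (b y)) x) :
    IsLieAlgebroid Γ bracket ρ := by
  have skew' : ∀ a ∈ Γ, ∀ b ∈ Γ, bracket a b = -bracket b a := fun a ha b hb =>
    funext (skew a ha b hb)
  have smul_left : ∀ r : ℝ, ∀ a ∈ Γ, ∀ b ∈ Γ, bracket (r • a) b = r • bracket a b := by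
    intro r a ha b hb
    have smul_right : bracket b (r • a) = r • bracket b a := funext fun x =>
      (leibniz (fun _ => r) contMDiff_const b hb a ha x).trans
        (by rw [dirDeriv_const, zero_smul, add_zero, Pi.smul_apply])
    rw [skew' _ (smul_mem r a ha) b hb, smul_right, skew' a ha b hb, smul_neg]
  exact {
    bracket_mem, anchor_smooth, smul_left, leibniz, anchor_bracket
    skew := skew'
    add_left := fun a ha b hb c hc => funext fun x => by
      rw [skew _ (add_mem a ha b hb) c hc, add_right c hc a ha b hb, Pi.add_apply,
        skew a ha c hc, skew b hb c hc, neg_add]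
    jacobi := fun a ha b hb c hc => funext fun x => by
      have neg_left : bracket (bracket c a) b = -bracket (bracket a c) b := by
        rw [skew' c hc a ha, ← neg_one_smul ℝ (bracket a c), smul_left _ _ (bracket_mem a ha c hc)
          b hb, neg_one_smul]
      rw [Pi.add_apply, Pi.add_apply, skew _ (bracket_mem b hb c hc) a ha,
        derivation a ha b hb c hc, neg_left, Pi.neg_apply, skew _ (bracket_mem a ha c hc) b hb,
        Pi.zero_apply]
      abel }

theorem IsLieAlgebroid.of_injective (h : IsLieAlgebroid Γ bracket ρ) {W : M → Type*}
    [∀ x, AddCommGroup (W x)] [∀ x, Module ℝ (W x)] {Γ' : Set (∀ x, W x)}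
    {bracket' : (∀ x, W x) → (∀ x, W x) → ∀ x, W x} (φ : ∀ x, W x →ₗ[ℝ] V x)
    (injective : ∀ x, Function.Injective (φ x)) (map_mem : ∀ a ∈ Γ', (fun x => φ x (a x)) ∈ Γ)
    (add_mem : ∀ a ∈ Γ', ∀ b ∈ Γ', a + b ∈ Γ')
    (smul_mem : ∀ f : M → ℝ, IsSmoothFun m f → ∀ a ∈ Γ', (fun x => f x • a x) ∈ Γ')
    (bracket_mem : ∀ a ∈ Γ', ∀ b ∈ Γ', bracket' a b ∈ Γ')
    (map_bracket : ∀ a ∈ Γ', ∀ b ∈ Γ', (fun x => φ x (bracket' a b x)) =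
      bracket (fun x => φ x (a x)) (fun x => φ x (b x))) :
    IsLieAlgebroid Γ' bracket' (fun x => ρ x ∘ₗ φ x) := by
  let push (a : ∀ x, W x) (x : M) : V x := φ x (a x)
  have push_injective : Function.Injective push := fun a b hab =>
    funext fun x => injective x (congrFun hab x)
  have push_add : ∀ a b, push (a + b) = push a + push b := fun a b =>
    funext fun x => map_add (φ x) (a x) (b x)
  have push_neg : ∀ a, push (-a) = -push a := fun a => funext fun x => map_neg (φ x) (a x)
  have push_smul : ∀ (f : M → ℝ) a, push (fun x => f x • a x) = fun x => f x • push a x :=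
    fun f a => funext fun x => map_smul (φ x) (f x) (a x)
  have push_bracket : ∀ a ∈ Γ', ∀ b ∈ Γ', push (bracket' a b) = bracket (push a) (push b) :=
    map_bracket
  exact {
    bracket_mem
    anchor_smooth := fun a ha => h.anchor_smooth _ (map_mem a ha)
    add_left := fun a ha b hb c hc => push_injective <| by
      rw [push_bracket _ (add_mem a ha b hb) c hc, push_add, push_add, push_bracket a ha c hc,
        push_bracket b hb c hc, h.add_left _ (map_mem a ha) _ (map_mem b hb) _ (map_mem c hc)]
    smul_left := fun r a ha b hb => push_injective <| by
      have push_const_smul : ∀ a, push (r • a) = r • push a := push_smul fun _ => r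
      have smul_mem_a : r • a ∈ Γ' := smul_mem _ contMDiff_const a ha
      rw [push_bracket _ smul_mem_a b hb, push_const_smul, push_const_smul,
        push_bracket a ha b hb, h.smul_left r _ (map_mem a ha) _ (map_mem b hb)]
    skew := fun a ha b hb => push_injective <| by
      rw [push_neg, push_bracket a ha b hb, push_bracket b hb a ha,
        h.skew _ (map_mem a ha) _ (map_mem b hb)]
    jacobi := fun a ha b hb c hc => push_injective <| by
      rw [push_add, push_add, push_bracket _ (bracket_mem a ha b hb) c hc,
        push_bracket _ (bracket_mem b hb c hc) a ha, push_bracket _ (bracket_mem c hc a ha) b hb,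
        push_bracket a ha b hb, push_bracket b hb c hc, push_bracket c hc a ha,
        h.jacobi _ (map_mem a ha) _ (map_mem b hb) _ (map_mem c hc)]
      exact funext fun x => (map_zero (φ x)).symm
    leibniz := fun f hf a ha b hb x => injective x <| by
      rw [map_add, map_smul, map_smul]
      refine (congrFun (push_bracket a ha _ (smul_mem f hf b hb)) x).trans ?_
      rw [push_smul, h.leibniz f hf _ (map_mem a ha) _ (map_mem b hb), ← push_bracket a ha b hb]
      rfl
    anchor_bracket := fun a ha b hb x =>
      (congrArg (ρ x) (congrFun (push_bracket a ha b hb) x)).trans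
        (h.anchor_bracket _ (map_mem a ha) _ (map_mem b hb) x) }

end LieAlgebroid

theorem isLieAlgebroid_of_isotropic [T2Space M] {L : ∀ x : M, Submodule ℝ (BigTangent m x)}
    (isotropic : ∀ x, ∀ v ∈ L x, ∀ w ∈ L x, g x v w = 0)
    {bracket : (∀ x, L x) → (∀ x, L x) → ∀ x, L x}
    (coe_bracket : ∀ a b, IsSmoothSection (fun x => (a x : BigTangent m x)) →
      IsSmoothSection (fun x => (b x : BigTangent m x)) →
      (fun x => (bracket a b x : BigTangent m x)) = dorfman (fun y => ↑(a y)) (fun y => ↑(b y))) :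
    IsLieAlgebroid {a : ∀ x, L x | IsSmoothSection (fun x => (a x : BigTangent m x))} bracket
      (fun x => LinearMap.fst ℝ _ _ ∘ₗ (L x).subtype) := by
  set Γ := {a : ∀ x, L x | IsSmoothSection (fun x => (a x : BigTangent m x))}
  have coe_apply : ∀ {a b}, a ∈ Γ → b ∈ Γ → ∀ x, (bracket a b x : BigTangent m x) =
      dorfman (fun y => ↑(a y)) (fun y => ↑(b y)) x :=
    fun ha hb => congrFun (coe_bracket _ _ ha hb)
  have add_mem : ∀ a ∈ Γ, ∀ b ∈ Γ, a + b ∈ Γ := fun a ha b hb => IsSmoothSection.add ha hb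
  have smul_mem : ∀ f : M → ℝ, IsSmoothFun m f → ∀ a ∈ Γ, (fun x => f x • a x) ∈ Γ :=
    fun f hf a ha => IsSmoothSection.smul hf ha
  have bracket_mem : ∀ a ∈ Γ, ∀ b ∈ Γ, bracket a b ∈ Γ := fun a ha b hb => by
    change IsSmoothSection _
    rw [coe_bracket a b ha hb]
    exact IsSmoothSection.dorfman ha hb
  refine .of_leibniz add_mem (fun r => smul_mem _ contMDiff_const) bracket_mem
    (fun a ha => ha.1) (fun a ha b hb x => Subtype.ext ?_)
    (fun a ha b hb c hc x => Subtype.ext ?_) (fun f hf a ha b hb x => Subtype.ext ?_)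
    (fun a ha b hb c hc x => Subtype.ext ?_)
    (fun a ha b hb x => congrArg Prod.fst (coe_apply ha hb x))
  · rw [coe_apply ha hb]
    refine (dorfman_swap_of_orthogonal ha hb (fun y => isotropic y _ (a y).2 _ (b y).2) x).trans ?_
    rw [← coe_apply hb ha]
    rfl
  · rw [coe_apply ha (add_mem b hb c hc)]
    refine (dorfman_add_right ha hb hc x).trans ?_
    rw [← coe_apply ha hb, ← coe_apply ha hc]
    rfl
  · rw [coe_apply ha (smul_mem f hf b hb)]
    refine (dorfman_smul_right ha hf hb x).trans ?_
    rw [← coe_apply ha hb]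
    rfl
  · rw [coe_apply ha (bracket_mem b hb c hc), coe_bracket b c hb hc, dorfman_leibniz ha hb hc,
      ← coe_bracket a b ha hb, ← coe_bracket a c ha hc, ← coe_apply (bracket_mem a ha b hb) hc,
      ← coe_apply hb (bracket_mem a ha c hc)]
    rfl

namespace TwoNilpotent

/-! ### Sections of `E` and `E*` -/

section Sections

variable (τ : TwoNilpotent m M)

theorem g_map_left (x : M) (v w : BigTangent m x) : g x (τ.map x v) w = -g x v (τ.map x w) := by
  linarith [τ.skew x v w]

theorem g_eq_zero_of_mem (x : M) : ∀ v ∈ τ.E x, ∀ w ∈ τ.E x, g x v w = 0 := by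
  rintro _ ⟨v, rfl⟩ _ ⟨w, rfl⟩
  rw [g_map_left, τ.map_map, map_zero, neg_zero]

theorem sharp_injective (x : M) : Function.Injective (τ.sharp x) := by
  refine (injective_iff_map_eq_zero _).2 fun ξ hξ => ?_
  obtain ⟨v, rfl⟩ := τ.toDual_surjective x ξ
  rw [toDual_eq_zero_iff, ← sharp_toDual, hξ]
  rfl

theorem dual_sharp_swap (x : M) (ξ η : τ.Edual x) : η (τ.sharp x ξ) = -ξ (τ.sharp x η) := by
  obtain ⟨v, rfl⟩ := τ.toDual_surjective x ξ
  obtain ⟨w, rfl⟩ := τ.toDual_surjective x η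
  rw [toDual_apply, toDual_apply, sharp_toDual, sharp_toDual, ← g_map_left, g_comm]

/-- The section of `E*` represented by a section of `TM ⊕ T*M`. -/
def toDualSec (s : ∀ x : M, BigTangent m x) (x : M) : τ.Edual x := τ.toDual x (s x)

variable {τ}

theorem toDualSec_mem_secDual (hs : IsSmoothSection s) : τ.toDualSec s ∈ τ.secDual :=
  ⟨s, hs, fun _ => rfl⟩

theorem exists_eq_toDualSec {α : ∀ x, τ.Edual x} (hα : α ∈ τ.secDual) :
    ∃ s, IsSmoothSection s ∧ τ.toDualSec s = α :=
  let ⟨s, hs, h⟩ := hα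
  ⟨s, hs, (funext h).symm⟩

theorem coe_sharpSec_toDualSec (s : ∀ x : M, BigTangent m x) :
    (fun x => (τ.sharpSec (τ.toDualSec s) x : BigTangent m x)) = τ.app s :=
  funext fun x => τ.sharp_toDual x (s x)

theorem isSmoothSection_app (hs : IsSmoothSection s) : IsSmoothSection (τ.app s) := τ.smooth s hs

theorem sharpSec_mem_secE {α : ∀ x, τ.Edual x} (hα : α ∈ τ.secDual) : τ.sharpSec α ∈ τ.secE := by
  obtain ⟨s, hs, rfl⟩ := exists_eq_toDualSec hα
  change IsSmoothSection _
  rw [coe_sharpSec_toDualSec]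
  exact isSmoothSection_app hs

theorem isSmoothFun_dual_apply {α : ∀ x, τ.Edual x} (hα : α ∈ τ.secDual) {e : ∀ x, τ.E x}
    (he : e ∈ τ.secE) : IsSmoothFun m (fun x => α x (e x)) := by
  obtain ⟨s, hs, rfl⟩ := exists_eq_toDualSec hα
  exact hs.g he

theorem isSmoothFun_bivector {α β : ∀ x, τ.Edual x} (hα : α ∈ τ.secDual) (hβ : β ∈ τ.secDual) :
    IsSmoothFun m (τ.bivector α β) :=
  isSmoothFun_dual_apply hβ (sharpSec_mem_secE hα)

theorem bivector_swap (α β : ∀ x, τ.Edual x) :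
    τ.bivector α β = fun x => -τ.bivector β α x :=
  funext fun x => τ.dual_sharp_swap x (α x) (β x)

theorem dE_eq_toDual (f : M → ℝ) (x : M) : τ.dE f x = τ.toDual x (gradient f x) := by
  refine LinearMap.ext fun v => ?_
  rw [toDual_apply, g_gradient]
  rfl

theorem gradient_g_app (s t : ∀ x : M, BigTangent m x) (x : M) :
    gradient (m := m) (fun y => g y (s y) (τ.app t y)) x =
      -gradient (m := m) (fun y => g y (τ.app s y) (t y)) x := by
  rw [← gradient_neg]
  congr 1
  funext y
  rw [app, app, g_map_left, neg_neg]

theorem derivE_neg (e : ∀ x, τ.E x) (f : M → ℝ) (x : M) :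
    τ.derivE e (fun y => -f y) x = -τ.derivE e f x :=
  dirDeriv_neg _ _ x

theorem derivE_sub (e : ∀ x, τ.E x) {f h : M → ℝ} (hf : IsSmoothFun m f) (hh : IsSmoothFun m h)
    (x : M) : τ.derivE e (fun y => f y - h y) x = τ.derivE e f x - τ.derivE e h x :=
  dirDeriv_sub _ hf hh x

theorem isSmoothFun_derivE {e : ∀ x, τ.E x} (he : e ∈ τ.secE) {f : M → ℝ} (hf : IsSmoothFun m f) :
    IsSmoothFun m (τ.derivE e f) :=
  hf.dirDeriv he.1

variable [T2Space M]

theorem exists_mem_secE {x : M} (v : τ.E x) : ∃ e ∈ τ.secE, e x = v := by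
  obtain ⟨_, w, rfl⟩ := v
  obtain ⟨s, hs, rfl⟩ := exists_isSmoothSection_eq w
  exact ⟨fun y => ⟨τ.map y (s y), s y, rfl⟩, τ.smooth s hs, rfl⟩

theorem dual_ext {x : M} {ξ η : τ.Edual x} (h : ∀ e ∈ τ.secE, ξ (e x) = η (e x)) : ξ = η := by
  refine LinearMap.ext fun v => ?_
  obtain ⟨e, he, rfl⟩ := exists_mem_secE v
  exact h e he

theorem ext_secDual {x : M} {v w : τ.E x} (h : ∀ α ∈ τ.secDual, α x v = α x w) : v = w := by
  refine Subtype.ext (bigTangent_ext fun s hs => ?_)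
  rw [g_comm, g_comm x (w : BigTangent m x)]
  exact h _ (toDualSec_mem_secDual hs)

theorem add_mem_secDual {α β : ∀ x, τ.Edual x} (hα : α ∈ τ.secDual) (hβ : β ∈ τ.secDual) :
    α + β ∈ τ.secDual := by
  obtain ⟨s, hs, rfl⟩ := exists_eq_toDualSec hα
  obtain ⟨t, ht, rfl⟩ := exists_eq_toDualSec hβ
  exact ⟨_, hs.add ht, fun x => (map_add _ _ _).symm⟩

theorem smul_mem_secDual {f : M → ℝ} (hf : IsSmoothFun m f) {α : ∀ x, τ.Edual x}
    (hα : α ∈ τ.secDual) : (fun x => f x • α x) ∈ τ.secDual := by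
  obtain ⟨s, hs, rfl⟩ := exists_eq_toDualSec hα
  exact ⟨_, hs.smul hf, fun x => (map_smul _ _ _).symm⟩

end Sections

/-! ### Calculus on the Lie algebroid `E` -/

section Calculus

variable {τ : TwoNilpotent m M} (hτ : τ.IsWeaklyIntegrable) {e e' : ∀ x, τ.E x}
  {α β : ∀ x, τ.Edual x}
include hτ

theorem coe_bracketE (he : e ∈ τ.secE) (he' : e' ∈ τ.secE) :
    (fun x => (τ.bracketE e e' x : BigTangent m x)) =
      dorfman (fun y => ↑(e y)) (fun y => ↑(e' y)) := by
  funext x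
  rw [bracketE, dif_pos (hτ _ _ he he' (fun y => (e y).2) (fun y => (e' y).2) x)]
  exact courant_eq_dorfman_of_orthogonal he he'
    (fun y => τ.g_eq_zero_of_mem y _ (e y).2 _ (e' y).2) x

theorem coe_bracketE_apply (he : e ∈ τ.secE) (he' : e' ∈ τ.secE) (x : M) :
    (τ.bracketE e e' x : BigTangent m x) = dorfman (fun y => ↑(e y)) (fun y => ↑(e' y)) x :=
  congrFun (coe_bracketE hτ he he') x

theorem dual_bracketE_swap (he : e ∈ τ.secE) (he' : e' ∈ τ.secE) {x : M} (ξ : τ.Edual x) :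
    ξ (τ.bracketE e e' x) = -ξ (τ.bracketE e' e x) := by
  obtain ⟨v, rfl⟩ := τ.toDual_surjective x ξ
  rw [toDual_apply, toDual_apply, coe_bracketE_apply hτ he he', coe_bracketE_apply hτ he' he,
    ← map_neg, dorfman_swap_of_orthogonal he he'
      (fun y => τ.g_eq_zero_of_mem y _ (e y).2 _ (e' y).2)]

theorem toDualSec_dorfman_apply (he : e ∈ τ.secE) (he' : e' ∈ τ.secE) (ht : IsSmoothSection t)
    (x : M) :
    τ.toDualSec (dorfman (fun y => ↑(e y)) t) x (e' x) =
      τ.derivE e (fun y => τ.toDualSec t y (e' y)) x - τ.toDualSec t x (τ.bracketE e e' x) := by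
  simp only [toDualSec, toDual_apply, coe_bracketE_apply hτ he he']
  exact eq_sub_of_add_eq (dirDeriv_g he ht he' x).symm

variable [T2Space M]

theorem isLieAlgebroid_E : IsLieAlgebroid τ.secE τ.bracketE τ.anchorE :=
  isLieAlgebroid_of_isotropic τ.g_eq_zero_of_mem fun _ _ => coe_bracketE hτ

theorem bracketE_mem (he : e ∈ τ.secE) (he' : e' ∈ τ.secE) : τ.bracketE e e' ∈ τ.secE :=
  (isLieAlgebroid_E hτ).bracket_mem e he e' he'

theorem derivE_bracketE (he : e ∈ τ.secE) (he' : e' ∈ τ.secE) {f : M → ℝ}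
    (hf : IsSmoothFun m f) (x : M) :
    τ.derivE (τ.bracketE e e') f x =
      τ.derivE e (τ.derivE e' f) x - τ.derivE e' (τ.derivE e f) x := by
  rw [derivE, funext ((isLieAlgebroid_E hτ).anchor_bracket e he e' he')]
  exact dirDeriv_mlieBracket he.1 he'.1 hf x

theorem lieDual_toDualSec (he : e ∈ τ.secE) (ht : IsSmoothSection t) :
    τ.lieDual e (τ.toDualSec t) = τ.toDualSec (dorfman (fun y => ↑(e y)) t) := by
  funext x
  have exists_spec : ∃ ξ : τ.Edual x, ∀ e' ∈ τ.secE, ξ (e' x) =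
      τ.derivE e (fun y => τ.toDualSec t y (e' y)) x - τ.toDualSec t x (τ.bracketE e e' x) :=
    ⟨_, fun _ he' => toDualSec_dorfman_apply hτ he he' ht x⟩
  rw [lieDual, dif_pos exists_spec]
  exact dual_ext fun e' he' =>
    (exists_spec.choose_spec e' he').trans (toDualSec_dorfman_apply hτ he he' ht x).symm

theorem lieDual_mem (he : e ∈ τ.secE) (hα : α ∈ τ.secDual) : τ.lieDual e α ∈ τ.secDual := by
  obtain ⟨t, ht, rfl⟩ := exists_eq_toDualSec hα
  rw [lieDual_toDualSec hτ he ht]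
  exact toDualSec_mem_secDual (IsSmoothSection.dorfman he ht)

theorem lieDual_apply (he : e ∈ τ.secE) (he' : e' ∈ τ.secE) (hα : α ∈ τ.secDual) (x : M) :
    τ.lieDual e α x (e' x) = τ.derivE e (fun y => α y (e' y)) x - α x (τ.bracketE e e' x) := by
  obtain ⟨t, ht, rfl⟩ := exists_eq_toDualSec hα
  rw [lieDual_toDualSec hτ he ht, toDualSec_dorfman_apply hτ he he' ht]

theorem lieDual_bracketE (he : e ∈ τ.secE) (he' : e' ∈ τ.secE) (hα : α ∈ τ.secDual) :
    τ.lieDual (τ.bracketE e e') α =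
      τ.lieDual e (τ.lieDual e' α) - τ.lieDual e' (τ.lieDual e α) := by
  obtain ⟨t, ht, rfl⟩ := exists_eq_toDualSec hα
  rw [lieDual_toDualSec hτ he ht, lieDual_toDualSec hτ he' ht,
    lieDual_toDualSec hτ he (IsSmoothSection.dorfman he' ht),
    lieDual_toDualSec hτ he' (IsSmoothSection.dorfman he ht),
    lieDual_toDualSec hτ (bracketE_mem hτ he he') ht, coe_bracketE hτ he he']
  funext x
  rw [Pi.sub_apply, toDualSec, toDualSec, toDualSec, ← map_sub, dorfman_leibniz he he' ht,
    add_sub_cancel_right]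

theorem lieBivector_bracketE {P : (∀ x, τ.Edual x) → (∀ x, τ.Edual x) → M → ℝ}
    (smooth : ∀ α ∈ τ.secDual, ∀ β ∈ τ.secDual, IsSmoothFun m (P α β))
    (sub_left : ∀ α α' β x, P (α - α') β x = P α β x - P α' β x)
    (sub_right : ∀ α β β' x, P α (β - β') x = P α β x - P α β' x)
    (he : e ∈ τ.secE) (he' : e' ∈ τ.secE) (hα : α ∈ τ.secDual) (hβ : β ∈ τ.secDual) (x : M) :
    τ.lieBivector (τ.bracketE e e') P α β x =
      τ.lieBivector e (τ.lieBivector e' P) α β x - τ.lieBivector e' (τ.lieBivector e P) α β x := by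
  have expand : ∀ a, ∀ b ∈ τ.secE, τ.lieBivector a (τ.lieBivector b P) α β x =
      τ.derivE a (τ.derivE b (P α β)) x - τ.derivE a (P (τ.lieDual b α) β) x
        - τ.derivE a (P α (τ.lieDual b β)) x - τ.lieBivector b P (τ.lieDual a α) β x
        - τ.lieBivector b P α (τ.lieDual a β) x := fun a b hb => by
    have smooth_deriv := isSmoothFun_derivE hb (smooth α hα β hβ)
    have smooth_left := smooth _ (lieDual_mem hτ hb hα) β hβ
    have smooth_right := smooth α hα _ (lieDual_mem hτ hb hβ)
    rw [← derivE_sub a smooth_deriv smooth_left,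
      ← derivE_sub a (smooth_deriv.sub smooth_left) smooth_right]
    rfl
  rw [expand e e' he', expand e' e he]
  simp only [lieBivector]
  rw [derivE_bracketE hτ he he' (smooth α hα β hβ), lieDual_bracketE hτ he he' hα,
    lieDual_bracketE hτ he he' hβ, sub_left, sub_right]
  ring

end Calculus

/-! ### The Gelfand-Dorfman bracket -/

section GelfandDorfman

variable {τ : TwoNilpotent m M}

theorem courant_app_add_courant_app (hs : IsSmoothSection s) (ht : IsSmoothSection t) (x : M) :
    courant s (τ.app t) x + courant (τ.app s) t x =
      dorfman s (τ.app t) x + dorfman (τ.app s) t x := by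
  rw [courant_eq_dorfman_sub hs (isSmoothSection_app ht),
    courant_eq_dorfman_sub (isSmoothSection_app hs) ht,
    gradient_g_app]
  module

theorem nijenhuis_eq (hs : IsSmoothSection s) (ht : IsSmoothSection t) (x : M) :
    τ.nijenhuis s t x = dorfman (τ.app s) (τ.app t) x
      - τ.map x (dorfman s (τ.app t) x + dorfman (τ.app s) t x) := by
  have isotropic : ∀ x, g x (τ.app s x) (τ.app t x) = 0 := fun x =>
    τ.g_eq_zero_of_mem x _ ⟨_, rfl⟩ _ ⟨_, rfl⟩
  rw [nijenhuis, τ.map_map, add_zero, sub_sub, ← map_add, courant_app_add_courant_app hs ht,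
    courant_eq_dorfman_of_orthogonal (isSmoothSection_app hs) (isSmoothSection_app ht) isotropic]

variable (τ) in
/-- The anchor `♯_Λ : E* → E` preserves the brackets of smooth sections. -/
def SharpPreservesBracket : Prop :=
  ∀ α ∈ τ.secDual, ∀ β ∈ τ.secDual, ∀ x,
    τ.sharp x (τ.gelfandDorfman α β x) = τ.bracketE (τ.sharpSec α) (τ.sharpSec β) x

variable [T2Space M] (hτ : τ.IsWeaklyIntegrable) {e e' : ∀ x, τ.E x} {α β γ : ∀ x, τ.Edual x}
include hτ

theorem gelfandDorfman_toDualSec (hs : IsSmoothSection s) (ht : IsSmoothSection t) :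
    τ.gelfandDorfman (τ.toDualSec s) (τ.toDualSec t) =
      τ.toDualSec (fun x => dorfman s (τ.app t) x + dorfman (τ.app s) t x) := by
  funext x
  have bivector_eq : τ.bivector (τ.toDualSec s) (τ.toDualSec t) =
      fun x => g x (τ.app s x) (t x) := funext (τ.bivector_toDual s t)
  have swap := dorfman_add_swap hs (isSmoothSection_app (τ := τ) ht) x
  rw [gradient_g_app] at swap
  rw [gelfandDorfman, lieDual_toDualSec hτ (sharpSec_mem_secE (toDualSec_mem_secDual hs)) ht,
    lieDual_toDualSec hτ (sharpSec_mem_secE (toDualSec_mem_secDual ht)) hs, bivector_eq,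
    coe_sharpSec_toDualSec, coe_sharpSec_toDualSec, dE_eq_toDual, toDualSec, toDualSec, toDualSec,
    ← map_sub, ← map_sub]
  congr 1
  rw [eq_sub_of_add_eq swap]
  abel

theorem gelfandDorfman_mem (hα : α ∈ τ.secDual) (hβ : β ∈ τ.secDual) :
    τ.gelfandDorfman α β ∈ τ.secDual := by
  obtain ⟨s, hs, rfl⟩ := exists_eq_toDualSec hα
  obtain ⟨t, ht, rfl⟩ := exists_eq_toDualSec hβ
  rw [gelfandDorfman_toDualSec hτ hs ht]
  exact toDualSec_mem_secDual ((hs.dorfman (isSmoothSection_app ht)).add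
    ((isSmoothSection_app hs).dorfman ht))

theorem gelfandDorfman_apply (hα : α ∈ τ.secDual) (hβ : β ∈ τ.secDual) (he : e ∈ τ.secE) (x : M) :
    τ.gelfandDorfman α β x (e x) =
      τ.derivE (τ.sharpSec α) (fun y => β y (e y)) x - β x (τ.bracketE (τ.sharpSec α) e x)
        - (τ.derivE (τ.sharpSec β) (fun y => α y (e y)) x - α x (τ.bracketE (τ.sharpSec β) e x))
        - τ.derivE e (τ.bivector α β) x := by
  rw [gelfandDorfman, LinearMap.sub_apply, LinearMap.sub_apply,
    lieDual_apply hτ (sharpSec_mem_secE hα) he hβ, lieDual_apply hτ (sharpSec_mem_secE hβ) he hα]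
  rfl

theorem isIntegrable_iff_sharpPreservesBracket : τ.IsIntegrable ↔ τ.SharpPreservesBracket := by
  have torsion_eq_zero_iff : ∀ s t, IsSmoothSection s → IsSmoothSection t → ∀ x,
      τ.nijenhuis s t x = 0 ↔
        τ.sharp x (τ.gelfandDorfman (τ.toDualSec s) (τ.toDualSec t) x) =
          τ.bracketE (τ.sharpSec (τ.toDualSec s)) (τ.sharpSec (τ.toDualSec t)) x := by
    intro s t hs ht x
    rw [nijenhuis_eq hs ht, sub_eq_zero, eq_comm, gelfandDorfman_toDualSec hτ hs ht,
      Subtype.ext_iff, toDualSec, sharp_toDual,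
      coe_bracketE_apply hτ (sharpSec_mem_secE (toDualSec_mem_secDual hs))
        (sharpSec_mem_secE (toDualSec_mem_secDual ht)),
      coe_sharpSec_toDualSec, coe_sharpSec_toDualSec]
  constructor
  · intro integrable α hα β hβ x
    obtain ⟨s, hs, rfl⟩ := exists_eq_toDualSec hα
    obtain ⟨t, ht, rfl⟩ := exists_eq_toDualSec hβ
    exact (torsion_eq_zero_iff s t hs ht x).1 (integrable s t hs ht x)
  · intro sharp_bracket s t hs ht x
    exact (torsion_eq_zero_iff s t hs ht x).2
      (sharp_bracket _ (toDualSec_mem_secDual hs) _ (toDualSec_mem_secDual ht) x)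

theorem isLieAlgebroid_dual (h : τ.SharpPreservesBracket) :
    IsLieAlgebroid τ.secDual τ.gelfandDorfman τ.anchorDual :=
  (isLieAlgebroid_E hτ).of_injective τ.sharp τ.sharp_injective (fun _ => sharpSec_mem_secE)
    (fun _ hα _ hβ => add_mem_secDual hα hβ) (fun _ hf _ hα => smul_mem_secDual hf hα)
    (fun _ hα _ hβ => gelfandDorfman_mem hτ hα hβ) (fun α hα β hβ => funext (h α hα β hβ))

/-! ### Triangular Lie bialgebroids -/

theorem schoutenSquare_eq (hα : α ∈ τ.secDual) (hβ : β ∈ τ.secDual) (hγ : γ ∈ τ.secDual) (x : M) :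
    τ.schoutenSquare α β γ x =
      2 * (γ x (τ.bracketE (τ.sharpSec α) (τ.sharpSec β) x)
        - γ x (τ.sharp x (τ.gelfandDorfman α β x))) := by
  have pairing : γ x (τ.sharp x (τ.gelfandDorfman α β x)) =
      τ.derivE (τ.sharpSec α) (τ.bivector β γ) x - α x (τ.bracketE (τ.sharpSec β) (τ.sharpSec γ) x)
        + τ.derivE (τ.sharpSec β) (τ.bivector γ α) x
        - β x (τ.bracketE (τ.sharpSec γ) (τ.sharpSec α) x)
        + τ.derivE (τ.sharpSec γ) (τ.bivector α β) x := by
    have apply_sharp : ∀ δ : ∀ x, τ.Edual x, (fun y => δ y (τ.sharpSec γ y)) = τ.bivector γ δ :=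
      fun _ => rfl
    have h := gelfandDorfman_apply hτ hα hβ (sharpSec_mem_secE hγ) x
    rw [apply_sharp, apply_sharp, bivector_swap γ β, derivE_neg,
      dual_bracketE_swap hτ (sharpSec_mem_secE hα) (sharpSec_mem_secE hγ)] at h
    rw [τ.dual_sharp_swap x (τ.gelfandDorfman α β x), ← sharpSec, h]
    ring
  rw [pairing, schoutenSquare]
  ring

theorem sharpPreservesBracket_iff_schoutenSquare_eq_zero : τ.SharpPreservesBracket ↔
    ∀ α ∈ τ.secDual, ∀ β ∈ τ.secDual, ∀ γ ∈ τ.secDual, ∀ x, τ.schoutenSquare α β γ x = 0 := by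
  constructor
  · intro h α hα β hβ γ hγ x
    rw [schoutenSquare_eq hτ hα hβ hγ, h α hα β hβ, sub_self, mul_zero]
  · intro h α hα β hβ x
    refine ext_secDual fun γ hγ => ?_
    have square_eq_zero := h α hα β hβ γ hγ x
    rw [schoutenSquare_eq hτ hα hβ hγ] at square_eq_zero
    linarith

theorem dStar_eq_neg_lieBivector (he : e ∈ τ.secE) (hα : α ∈ τ.secDual) (hβ : β ∈ τ.secDual) :
    τ.dStar e α β = fun x => -τ.lieBivector e τ.bivector α β x := by
  funext x
  have bivector_lieDual_left : τ.bivector (τ.lieDual e α) β x =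
      τ.derivE e (τ.bivector α β) x + α x (τ.bracketE e (τ.sharpSec β) x) := by
    have apply_sharp : (fun y => α y (τ.sharpSec β y)) = τ.bivector β α := rfl
    have h := lieDual_apply hτ he (sharpSec_mem_secE hβ) hα x
    rw [apply_sharp, bivector_swap β α, derivE_neg] at h
    exact (τ.dual_sharp_swap x _ _).trans (by rw [← sharpSec, h]; ring)
  have bivector_lieDual_right : τ.bivector α (τ.lieDual e β) x =
      τ.derivE e (τ.bivector α β) x - β x (τ.bracketE e (τ.sharpSec α) x) :=
    lieDual_apply hτ he (sharpSec_mem_secE hα) hβ x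
  rw [dStar, gelfandDorfman_apply hτ hα hβ he, lieBivector, bivector_lieDual_left,
    bivector_lieDual_right, dual_bracketE_swap hτ (sharpSec_mem_secE hα) he,
    dual_bracketE_swap hτ (sharpSec_mem_secE hβ) he]
  simp only [derivE, anchorDual, sharpSec, LinearMap.comp_apply]
  ring

theorem lieBivector_dStar (he : e ∈ τ.secE) (he' : e' ∈ τ.secE) (hα : α ∈ τ.secDual)
    (hβ : β ∈ τ.secDual) (x : M) :
    τ.lieBivector e (τ.dStar e') α β x =
      -τ.lieBivector e (τ.lieBivector e' τ.bivector) α β x := by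
  rw [lieBivector, dStar_eq_neg_lieBivector hτ he' hα hβ,
    dStar_eq_neg_lieBivector hτ he' (lieDual_mem hτ he hα) hβ,
    dStar_eq_neg_lieBivector hτ he' hα (lieDual_mem hτ he hβ), derivE_neg]
  simp only [lieBivector]
  ring

theorem dStar_bracketE (he : e ∈ τ.secE) (he' : e' ∈ τ.secE) (hα : α ∈ τ.secDual)
    (hβ : β ∈ τ.secDual) (x : M) :
    τ.dStar (τ.bracketE e e') α β x =
      τ.lieBivector e (τ.dStar e') α β x - τ.lieBivector e' (τ.dStar e) α β x := by
  have bivector_sub_left : ∀ α α' β x,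
      τ.bivector (α - α') β x = τ.bivector α β x - τ.bivector α' β x := fun α α' β x => by
    rw [bivector, sharpSec, Pi.sub_apply, map_sub, map_sub]
    rfl
  have bivector_sub_right : ∀ α β β' x,
      τ.bivector α (β - β') x = τ.bivector α β x - τ.bivector α β' x := fun _ _ _ _ => rfl
  have representation := lieBivector_bracketE hτ (P := τ.bivector)
    (fun _ hα _ hβ => isSmoothFun_bivector hα hβ) bivector_sub_left bivector_sub_right he he' hα hβ
  calc τ.dStar (τ.bracketE e e') α β x
      = -τ.lieBivector (τ.bracketE e e') τ.bivector α β x :=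
        congrFun (dStar_eq_neg_lieBivector hτ (bracketE_mem hτ he he') hα hβ) x
    _ = τ.lieBivector e (τ.dStar e') α β x - τ.lieBivector e' (τ.dStar e) α β x := by
        rw [representation, lieBivector_dStar hτ he he' hα hβ, lieBivector_dStar hτ he' he hα hβ]
        ring

end GelfandDorfman

end TwoNilpotent

end GenGeom

end

open GenGeom GenGeom.TwoNilpotent in
theorem proposition4p3_general (m : ℕ) (M : Type*) [TopologicalSpace M] [T2Space M]
    [ChartedSpace (EuclideanSpace ℝ (Fin m)) M] [IsManifold (𝓡 m) ∞ M]
    (τ : TwoNilpotent m M) (hτ : τ.IsWeaklyIntegrable) :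
    (τ.IsIntegrable ↔ τ.IsDualLieAlgebroid) ∧
      (τ.IsIntegrable ↔ τ.IsTriangularLieBialgebroid) := by
  rw [isIntegrable_iff_sharpPreservesBracket hτ]
  refine ⟨⟨fun h => ?dual, fun dual => dual.sharp_bracket⟩, ⟨fun h => ?bialgebroid, fun tri => ?_⟩⟩
  case dual => exact ⟨isLieAlgebroid_dual hτ h, h⟩
  case bialgebroid => exact {
    lieAlgebroid := isLieAlgebroid_E hτ
    lieAlgebroid_dual := isLieAlgebroid_dual hτ h
    compatible := fun _ he _ he' _ hα _ hβ => dStar_bracketE hτ he he' hα hβ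
    schouten := (sharpPreservesBracket_iff_schoutenSquare_eq_zero hτ).1 h }
  exact (sharpPreservesBracket_iff_schoutenSquare_eq_zero hτ).2 tri.schouten

theorem proposition4p3 (m : ℕ) (M : Type*) [TopologicalSpace M] [T2Space M]
    [SecondCountableTopology M] [ChartedSpace (EuclideanSpace ℝ (Fin m)) M]
    [IsManifold (𝓡 m) ∞ M] (τ : GenGeom.TwoNilpotent m M) (hτ : τ.IsWeaklyIntegrable) :
    (τ.IsIntegrable ↔ τ.IsDualLieAlgebroid) ∧
      (τ.IsIntegrable ↔ τ.IsTriangularLieBialgebroid) :=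
  proposition4p3_general m M τ hτ
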